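/- Let $2<k<N$ be integers. For a real symmetric $N\times N$ matrix $X$ with ordered eigenvalues $\lambda_1(X)\le\cdots\le\lambda_N(X)$ (counted with multiplicity) put $\mathcal P^+_k(X)=\sum_{i=N-k+1}^{N}\lambda_i(X)$, the sum of the $k$ largest eigenvalues, and for $p>0$ consider the equation $$\mathcal P^+_k(D^2u(x))+u(x)^p=0\quad\text{in }\mathbb R^N.\tag{E}$$ A classical solution (respectively, supersolution) of (E) is a function $u\in C^2(\mathbb R^N)$ satisfying $\mathcal P^+_k(D^2u)+u^p=0$ (respectively, $\le 0$) at every point. A nonnegative viscosity supersolution of (E) is a lower semicontinuous function $u:\mathbb R^N\to[0,\infty)$ such that, whenever $\varphi\in C^2(\mathbb R^N)$ and $x_0\in\mathbb R^N$ satisfy $\varphi(x_0)=u(x_0)$ and $\varphi\le u$ in a neighbourhood of $x_0$, one has $\mathcal P^+_k(D^2\varphi(x_0))+u(x_0)^p\le 0$. A function on $\mathbb R^N$ is radial if its value at $x$ depends only on the Euclidean norm $|x|$. Then: 1. For $0<p\le\frac{k}{k-2}$ the only nonnegative viscosity supersolution of (E) is $u\equiv0$. 2. For every $p>\frac{k}{k-2}$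 there exist classical supersolutions of (E) that are positive on $\mathbb R^N$. 3. For every $p\ge\frac{k+2}{k-2}$ there exist classical solutions of (E) that are positive on $\mathbb R^N$. 4. For $\frac{k}{k-2}<p<\frac{k+2}{k-2}$ there are no radial classical solutions of (E) that are positive on $\mathbb R^N$. -/

import Mathlib

open Topology

noncomputable section

namespace TruncatedLaplacian

/-- The Hessian matrix `D²u(x)`, with entries the second partial derivatives
`∂ᵢ∂ⱼu(x)` in the standard coordinates of `ℝᴺ`. -/
def hessian {N : ℕ} (u : EuclideanSpace ℝ (Fin N) → ℝ) (x : EuclideanSpace ℝ (Fin N)) :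
    Matrix (Fin N) (Fin N) ℝ :=
  Matrix.of fun i j =>
    fderiv ℝ (fderiv ℝ u) x (EuclideanSpace.single i 1) (EuclideanSpace.single j 1)

/-- The Hessian matrix of a `C²` function is symmetric. -/
theorem hessian_isHermitian {N : ℕ} {u : EuclideanSpace ℝ (Fin N) → ℝ}
    (hu : ContDiff ℝ 2 u) (x : EuclideanSpace ℝ (Fin N)) : (hessian u x).IsHermitian := by
  have h : IsSymmSndFDerivAt ℝ u x := hu.contDiffAt.isSymmSndFDerivAt (by simp)
  ext i j
  simpa [hessian] using h.eq _ _

/-- `𝒫⁺ₖ(X)`: the sum of the `k` largest eigenvalues, counted with multiplicity, of the real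
symmetric `N × N` matrix `X`. Mathlib's `eigenvalues₀` lists the eigenvalues in decreasing
order, so these are the ones with index `0, …, k - 1`. -/
def Pplus {N : ℕ} (k : ℕ) (X : Matrix (Fin N) (Fin N) ℝ) (hX : X.IsHermitian) : ℝ :=
  ∑ i ∈ Finset.univ.filter (fun i : Fin (Fintype.card (Fin N)) => (i : ℕ) < k),
    hX.eigenvalues₀ i

/-- `u` is a classical (i.e. `C²`) solution of `𝒫⁺ₖ(D²u) + uᵖ = 0` in `ℝᴺ`. -/
def IsClassicalSolution {N : ℕ} (k : ℕ) (p : ℝ) (u : EuclideanSpace ℝ (Fin N) → ℝ) : Prop :=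
  ∃ hu : ContDiff ℝ 2 u, ∀ x, Pplus k (hessian u x) (hessian_isHermitian hu x) + u x ^ p = 0

/-- `u` is a classical (i.e. `C²`) supersolution of `𝒫⁺ₖ(D²u) + uᵖ = 0` in `ℝᴺ`. -/
def IsClassicalSupersolution {N : ℕ} (k : ℕ) (p : ℝ) (u : EuclideanSpace ℝ (Fin N) → ℝ) :
    Prop :=
  ∃ hu : ContDiff ℝ 2 u, ∀ x, Pplus k (hessian u x) (hessian_isHermitian hu x) + u x ^ p ≤ 0

/-- `u` is a viscosity supersolution of `𝒫⁺ₖ(D²u) + uᵖ = 0` in `ℝᴺ`: it is lower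
semicontinuous, and whenever a `C²` function `φ` touches `u` from below at `x₀`, one has
`𝒫⁺ₖ(D²φ(x₀)) + u(x₀)ᵖ ≤ 0`. -/
def IsViscositySupersolution {N : ℕ} (k : ℕ) (p : ℝ) (u : EuclideanSpace ℝ (Fin N) → ℝ) :
    Prop :=
  LowerSemicontinuous u ∧
    ∀ (φ : EuclideanSpace ℝ (Fin N) → ℝ) (hφ : ContDiff ℝ 2 φ) (x₀ : EuclideanSpace ℝ (Fin N)),
      φ x₀ = u x₀ → (∀ᶠ x in 𝓝 x₀, φ x ≤ u x) →
        Pplus k (hessian φ x₀) (hessian_isHermitian hφ x₀) + u x₀ ^ p ≤ 0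

/-- `u` is radial: `u(x)` depends only on `|x|`. -/
def IsRadial {N : ℕ} (u : EuclideanSpace ℝ (Fin N) → ℝ) : Prop :=
  ∃ g : ℝ → ℝ, ∀ x, u x = g ‖x‖

end TruncatedLaplacian

end

/-!
In the variable `t = |x|²` everything becomes one-dimensional. For `u(x) = h(|x|²)` the Hessian is
`2h' I + 4h'' x xᵀ`, with eigenvalue `2h'` of multiplicity `N - 1` and simple eigenvalue
`2h' + 4t h''`, so that `k < N` gives `𝒫⁺ₖ(D²u) = 2k h' + 4t max(h'', 0)`
(`Pplus_hessian_comp_normSq_sub`). Where `h'' ≥ 0` this is the radial Laplacian in dimension `k`, and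
the exponents are those of the Lane–Emden equation in `ℝᵏ`.

* Liouville property. A viscosity supersolution `u ≥ 0` that is positive somewhere lies above a
  multiple of `t^(1 - k/2)`, by comparison with shifted fundamental solutions
  (`IsViscositySupersolution.lower_bound`). For `p ≤ k / (k - 2)` the term `uᵖ` then has at least the
  size `t^(-k/2)`, which improves the bound by a logarithm (`log_lower_bound`). Testing with a
  paraboloid bounds the minimum `m` over a ball of radius `R` by `m^(p-1) ≤ C / R²` (`min_rpow_le`),
  and the two bounds are incompatible for large `R`.
* Supersolutions. For `p > k / (k - 2)`, a small multiple of `(1 + |x|²)^(-1/(p-1))` is one.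
* Radial solutions. The equation forces `h'' ≥ 0` (`second_deriv_nonneg`), so that positive radial
  solutions are Lane–Emden profiles `4t h'' + 2k h' + hᵖ = 0`. Along these the Pohozaev functional
  has a derivative of constant sign (`hasDerivAt_pohozaev`). Below the exponent `(k + 2) / (k - 2)`
  it increases from `0`, contradicting the decay of `h` and `h'` (`not_exists_profile`). From that
  exponent on it does not increase, so that the profile with `h(0) = 1` cannot reach zero
  (`exists_pos_profile`). This profile is obtained on all of `ℝ` as the fixed point of a Volterra
  operator, for a globally Lipschitz modification of the power (`exists_picard_eq`). Its `C²`
  regularity in `t` up to and across `t = 0` is what makes `x ↦ h(|x|²)` of class `C²`.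
-/

noncomputable section

namespace TruncatedLaplacian

/-! ### Truncated sums of eigenvalues -/

/-- A decreasing list whose entries are `0` or `s` and whose total is `s` carries the value `s`
exactly once (if `s ≠ 0`): in first position when `s > 0`, in last position when `s < 0`. -/
theorem sum_filter_lt_eq_max {n k : ℕ} (hk : 0 < k) (hkn : k < n) {e : Fin n → ℝ} {s : ℝ}
    (he : Antitone e) (hes : ∀ i, e i = 0 ∨ e i = s) (hsum : ∑ i, e i = s) :
    ∑ i ∈ Finset.univ.filter (fun i : Fin n => (i : ℕ) < k), e i = max s 0 := by
  have h0n : 0 < n := hk.trans hkn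
  rcases lt_trichotomy s 0 with hs | hs | hs
  · rw [max_eq_right hs.le]
    apply Finset.sum_eq_zero
    intro i hi
    have hik : (i : ℕ) < k := by simpa using hi
    by_contra hne
    have hi' : e i = s := (hes i).resolve_left hne
    let j : Fin n := ⟨n - 1, by omega⟩
    have hij : i ≠ j := by
      intro h
      have := congrArg Fin.val h
      simp only [j] at this
      omega
    have hj : e j ≤ e i := he (by rw [Fin.le_def]; simp only [j]; omega)
    have hle : ∑ l, e l ≤ ∑ l ∈ ({i, j} : Finset (Fin n)), e l := by
      rw [← Finset.sum_sdiff (Finset.subset_univ ({i, j} : Finset (Fin n)))]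
      have : ∑ l ∈ Finset.univ \ ({i, j} : Finset (Fin n)), e l ≤ 0 :=
        Finset.sum_nonpos fun l _ => by rcases hes l with h | h <;> rw [h]; exact hs.le
      linarith
    rw [Finset.sum_pair hij] at hle
    linarith
  · subst hs
    rw [max_self]
    exact Finset.sum_eq_zero fun i _ => by rcases hes i with h | h <;> exact h
  · rw [max_eq_left hs.le]
    have hnn : ∀ i, 0 ≤ e i := fun i => by rcases hes i with h | h <;> rw [h]; exact hs.le
    apply le_antisymm
    · calc _ ≤ ∑ i, e i :=
            Finset.sum_le_sum_of_subset_of_nonneg (Finset.filter_subset _ _) fun i _ _ => hnn i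
        _ = s := hsum
    · have h0 : e ⟨0, h0n⟩ = s := by
        refine (hes _).resolve_left fun h => ?_
        have : ∑ i, e i ≤ 0 := Finset.sum_nonpos fun i _ => by
          rw [← h]
          exact he (by rw [Fin.le_def]; simp)
        linarith
      calc s = e ⟨0, h0n⟩ := h0.symm
        _ ≤ _ := Finset.single_le_sum (f := e) (fun i _ => hnn i) (by simpa using hk)

/-- The eigenvalues of `α I + β w wᵀ` are `α` and `α + β |w|²`. -/
theorem eigenvalues_smul_one_add_vecMulVec {N : ℕ} {X : Matrix (Fin N) (Fin N) ℝ}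
    (hX : X.IsHermitian) {α β : ℝ} {w : Fin N → ℝ}
    (h : X = α • (1 : Matrix (Fin N) (Fin N) ℝ) + β • Matrix.vecMulVec w w) (j : Fin N) :
    hX.eigenvalues j - α = 0 ∨ hX.eigenvalues j - α = β * (w ⬝ᵥ w) := by
  set v : Fin N → ℝ := (hX.eigenvectorBasis j).ofLp with hv
  have hvne : v ≠ 0 := by
    intro h0
    have h1 := hX.eigenvectorBasis.orthonormal.ne_zero j
    exact h1 (by ext i; simpa [hv] using congrFun h0 i)
  have hev : X.mulVec v = hX.eigenvalues j • v := hX.mulVec_eigenvectorBasis j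
  set l := hX.eigenvalues j
  have h1 : (l - α) • v = (β * (w ⬝ᵥ v)) • w := by
    rw [h, Matrix.add_mulVec, Matrix.smul_mulVec, Matrix.smul_mulVec, Matrix.one_mulVec,
      Matrix.vecMulVec_mulVec] at hev
    ext i
    have := congrFun hev i
    simp only [Pi.add_apply, Pi.smul_apply, smul_eq_mul, MulOpposite.smul_eq_mul_unop,
      MulOpposite.unop_op] at this ⊢
    linarith
  by_cases hl : l - α = 0
  · exact Or.inl hl
  · right
    have hwv : w ⬝ᵥ v ≠ 0 := by
      intro h0
      rw [h0, mul_zero, zero_smul] at h1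
      exact (smul_ne_zero hl hvne) h1
    have h2 := congrArg (fun z => w ⬝ᵥ z) h1
    simp only [dotProduct_smul, smul_eq_mul] at h2
    have : (l - α - β * (w ⬝ᵥ w)) * (w ⬝ᵥ v) = 0 := by linarith
    rcases mul_eq_zero.1 this with h3 | h3
    · linarith
    · exact absurd h3 hwv

theorem Pplus_smul_one_add_vecMulVec {N k : ℕ} (hk : 0 < k) (hkN : k < N)
    {X : Matrix (Fin N) (Fin N) ℝ} (hX : X.IsHermitian) {α β : ℝ} {w : Fin N → ℝ}
    (h : X = α • (1 : Matrix (Fin N) (Fin N) ℝ) + β • Matrix.vecMulVec w w) :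
    Pplus k X hX = k * α + max (β * (w ⬝ᵥ w)) 0 := by
  have hkN' : k < Fintype.card (Fin N) := by simpa using hkN
  let φ : Fin (Fintype.card (Fin N)) ≃ Fin N := Fintype.equivOfCardEq (Fintype.card_fin _)
  have hφ : ∀ i, hX.eigenvalues₀ i = hX.eigenvalues (φ i) := fun i => by
    simp [Matrix.IsHermitian.eigenvalues, φ]
  have htr : ∑ i, (hX.eigenvalues₀ i - α) = β * (w ⬝ᵥ w) := by
    have h1 : X.trace = ∑ i, hX.eigenvalues i := by
      simpa using hX.trace_eq_sum_eigenvalues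
    have h2 : X.trace = α * N + β * (w ⬝ᵥ w) := by
      rw [h, Matrix.trace_add, Matrix.trace_smul, Matrix.trace_smul, Matrix.trace_one,
        Matrix.trace_vecMulVec]
      simp
    rw [Finset.sum_sub_distrib, Finset.sum_congr rfl fun i _ => hφ i,
      Equiv.sum_comp φ hX.eigenvalues, ← h1, h2]
    simp
    ring
  have key := sum_filter_lt_eq_max hk hkN' (e := fun i => hX.eigenvalues₀ i - α)
    (fun i j hij => sub_le_sub_right (hX.eigenvalues₀_antitone hij) _)
    (fun i => by simpa only [hφ] using eigenvalues_smul_one_add_vecMulVec hX h (φ i)) htr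
  rw [Finset.sum_sub_distrib] at key
  have hcard : (Finset.univ.filter
      (fun i : Fin (Fintype.card (Fin N)) => (i : ℕ) < k)).card = k := by
    rw [Fin.card_filter_val_lt, min_eq_right hkN'.le]
  rw [Finset.sum_const, hcard, nsmul_eq_mul] at key
  unfold Pplus
  linarith

theorem Pplus_nonpos {N : ℕ} (k : ℕ) {X : Matrix (Fin N) (Fin N) ℝ} (hX : X.IsHermitian)
    (h : ∀ v : Fin N → ℝ, v ⬝ᵥ X.mulVec v ≤ 0) : Pplus k X hX ≤ 0 := by
  refine Finset.sum_nonpos fun i _ => ?_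
  let φ : Fin (Fintype.card (Fin N)) ≃ Fin N := Fintype.equivOfCardEq (Fintype.card_fin _)
  have hφ : hX.eigenvalues₀ i = hX.eigenvalues (φ i) := by
    simp [Matrix.IsHermitian.eigenvalues, φ]
  set v : Fin N → ℝ := (hX.eigenvectorBasis (φ i)).ofLp with hv
  have hvne : v ≠ 0 := by
    intro h0
    have h1 := hX.eigenvectorBasis.orthonormal.ne_zero (φ i)
    exact h1 (by ext i; simpa [hv] using congrFun h0 i)
  have hev : X.mulVec v = hX.eigenvalues (φ i) • v := hX.mulVec_eigenvectorBasis (φ i)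
  have h1 := h v
  rw [hev, dotProduct_smul, smul_eq_mul] at h1
  have h2 : 0 < v ⬝ᵥ v :=
    lt_of_le_of_ne (Finset.sum_nonneg fun i _ => mul_self_nonneg (v i))
      (Ne.symm (by simpa using hvne))
  rw [hφ]
  by_contra hc
  push Not at hc
  linarith [mul_pos hc h2]

/-! ### Hessians of functions of the squared distance -/

section Radial

variable {N : ℕ}

local notation "E" => EuclideanSpace ℝ (Fin N)

theorem hasFDerivAt_normSq_sub (y z : E) :
    HasFDerivAt (fun x : E => ‖x - y‖ ^ 2) ((2 : ℝ) • innerSL ℝ (z - y)) z := by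
  have h := ((hasFDerivAt_id z).sub_const y).norm_sq
  refine h.congr_fderiv ?_
  ext v
  simp

/-- If `u(x) = h(|x - y|²)` near `x₀`, then `D²u(x₀) = 2h' I + 4h'' (x₀ - y)(x₀ - y)ᵀ`, where
`h1 = h'` near `|x₀ - y|²` and `h2 = h''` at that point. -/
theorem hessian_comp_normSq_sub {u : E → ℝ} {h h1 : ℝ → ℝ} {h2 : ℝ} (y x₀ : E)
    (hu : u =ᶠ[𝓝 x₀] fun x => h (‖x - y‖ ^ 2))
    (hh : ∀ᶠ s in 𝓝 (‖x₀ - y‖ ^ 2), HasDerivAt h (h1 s) s)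
    (hh1 : HasDerivAt h1 h2 (‖x₀ - y‖ ^ 2)) :
    hessian u x₀ = (2 * h1 (‖x₀ - y‖ ^ 2)) • (1 : Matrix (Fin N) (Fin N) ℝ) +
      (4 * h2) • Matrix.vecMulVec (x₀ - y).ofLp (x₀ - y).ofLp := by
  have hc : Filter.Tendsto (fun x : E => ‖x - y‖ ^ 2) (𝓝 x₀) (𝓝 (‖x₀ - y‖ ^ 2)) :=
    (hasFDerivAt_normSq_sub y x₀).continuousAt
  have hf : fderiv ℝ u =ᶠ[𝓝 x₀]
      fun x => (2 * h1 (‖x - y‖ ^ 2)) • innerSL ℝ (x - y) := by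
    filter_upwards [hu.eventuallyEq_nhds, hc.eventually hh] with x hx1 hx2
    rw [hx1.fderiv_eq]
    have := hx2.comp_hasFDerivAt x (hasFDerivAt_normSq_sub y x)
    rw [show (fun x : E => h (‖x - y‖ ^ 2)) = h ∘ fun x : E => ‖x - y‖ ^ 2 from rfl,
      this.fderiv, smul_smul, mul_comm]
  have hi : HasFDerivAt (fun x : E => innerSL ℝ (x - y)) (innerSL ℝ : E →L[ℝ] E →L[ℝ] ℝ) x₀ := by
    have h0 : HasFDerivAt (fun x : E => x - y) (ContinuousLinearMap.id ℝ E) x₀ :=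
      (hasFDerivAt_id x₀).sub_const y
    exact (innerSL ℝ : E →L[ℝ] E →L[ℝ] ℝ).hasFDerivAt.comp x₀ h0
  have hs : HasFDerivAt (fun x : E => 2 * h1 (‖x - y‖ ^ 2))
      ((2 : ℝ) • h2 • (2 : ℝ) • innerSL ℝ (x₀ - y)) x₀ :=
    (hh1.comp_hasFDerivAt x₀ (hasFDerivAt_normSq_sub y x₀)).const_mul 2
  have hD : HasFDerivAt (fun x : E => (2 * h1 (‖x - y‖ ^ 2)) • innerSL ℝ (x - y)) _ x₀ :=
    hs.smul hi
  ext i j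
  have hij : innerSL ℝ (EuclideanSpace.single i (1 : ℝ)) (EuclideanSpace.single j (1 : ℝ)) =
      if i = j then 1 else 0 := by
    rw [innerSL_apply_apply, EuclideanSpace.inner_single_left]
    simp
  rw [hessian, Matrix.of_apply, hf.fderiv_eq, hD.fderiv]
  simp [Matrix.vecMulVec_apply, Matrix.one_apply, EuclideanSpace.inner_single_right, hij]
  ring

/-- The truncated Laplacian of `x ↦ h(|x - y|²)`. The simple eigenvalue `2h' + 4|x - y|²h''`
contributes to the `k` largest ones exactly when `h'' ≥ 0`, because `k < N`. -/
theorem Pplus_hessian_comp_normSq_sub {k : ℕ} (hk : 0 < k) (hkN : k < N) {u : E → ℝ}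
    {h h1 : ℝ → ℝ} {h2 : ℝ} (y x₀ : E)
    (hH : (hessian u x₀).IsHermitian)
    (hu : u =ᶠ[𝓝 x₀] fun x => h (‖x - y‖ ^ 2))
    (hh : ∀ᶠ s in 𝓝 (‖x₀ - y‖ ^ 2), HasDerivAt h (h1 s) s)
    (hh1 : HasDerivAt h1 h2 (‖x₀ - y‖ ^ 2)) :
    Pplus k (hessian u x₀) hH =
      2 * k * h1 (‖x₀ - y‖ ^ 2) + 4 * ‖x₀ - y‖ ^ 2 * max h2 0 := by
  rw [Pplus_smul_one_add_vecMulVec hk hkN hH (hessian_comp_normSq_sub y x₀ hu hh hh1)]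
  have : (x₀ - y).ofLp ⬝ᵥ (x₀ - y).ofLp = ‖x₀ - y‖ ^ 2 := by
    rw [EuclideanSpace.norm_sq_eq]
    simp [dotProduct, sq]
  have hmax := max_mul_of_nonneg h2 0 (show 0 ≤ 4 * ‖x₀ - y‖ ^ 2 by positivity)
  rw [zero_mul] at hmax
  rw [this, show 4 * h2 * ‖x₀ - y‖ ^ 2 = h2 * (4 * ‖x₀ - y‖ ^ 2) by ring, ← hmax]
  ring

/-- Second order necessary condition at a local maximum. -/
theorem dotProduct_hessian_mulVec_nonpos_of_isLocalMax {φ : E → ℝ} (hφ : ContDiff ℝ 2 φ) {x₀ : E}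
    (hmax : IsLocalMax φ x₀) (v : Fin N → ℝ) : v ⬝ᵥ (hessian φ x₀).mulVec v ≤ 0 := by
  set w : E := WithLp.toLp 2 v with hw
  have hD : Differentiable ℝ φ := hφ.differentiable (by norm_num)
  have hD2 : Differentiable ℝ (fderiv ℝ φ) :=
    (hφ.fderiv_right (m := 1) (by norm_num)).differentiable (by norm_num)
  have hquad : v ⬝ᵥ (hessian φ x₀).mulVec v = fderiv ℝ (fderiv ℝ φ) x₀ w w := by
    have hsum : w = ∑ i, v i • EuclideanSpace.single i (1 : ℝ) := by
      ext i
      simp [hw, Finset.sum_apply, Pi.single_apply]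
    conv_rhs => rw [hsum]
    simp only [map_sum, map_smul, sum_apply, smul_apply,
      smul_eq_mul, dotProduct, Matrix.mulVec, hessian, Matrix.of_apply, Finset.mul_sum]
    rw [Finset.sum_comm]
    exact Finset.sum_congr rfl fun i _ => Finset.sum_congr rfl fun j _ => by ring
  rw [hquad]
  by_contra hc
  push Not at hc
  set q := fderiv ℝ (fderiv ℝ φ) x₀ w w with hq
  have hl : ∀ s : ℝ, HasDerivAt (fun s : ℝ => x₀ + s • w) w s := fun s => by
    simpa using ((hasDerivAt_id s).smul_const w).const_add x₀
  let g : ℝ → ℝ := fun s => φ (x₀ + s • w) - q / 4 * s ^ 2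
  have hg : ∀ s, HasDerivAt g (fderiv ℝ φ (x₀ + s • w) w - q / 2 * s) s := fun s => by
    have h1 := (hD (x₀ + s • w)).hasFDerivAt.comp_hasDerivAt s (hl s)
    have h2 := ((hasDerivAt_id s).pow 2).const_mul (q / 4)
    refine (h1.sub h2).congr_deriv ?_
    simp
    ring
  have hg' : deriv g = fun s => fderiv ℝ φ (x₀ + s • w) w - q / 2 * s :=
    funext fun s => (hg s).deriv
  have hg2 : HasDerivAt (deriv g) (q - q / 2) 0 := by
    rw [hg']
    have h1 := (hD2 (x₀ + (0 : ℝ) • w)).hasFDerivAt.comp_hasDerivAt (0 : ℝ) (hl 0)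
    have h2 := h1.clm_apply (hasDerivAt_const (0 : ℝ) w)
    have h3 := (hasDerivAt_id (0 : ℝ)).const_mul (q / 2)
    refine (h2.sub h3).congr_deriv ?_
    simp [hq]
  have hcr : fderiv ℝ φ x₀ = 0 := hmax.fderiv_eq_zero
  have hmin := isLocalMin_of_deriv_deriv_pos (f := g) (x₀ := 0)
    (by rw [hg2.deriv]; linarith) (by rw [hg']; simp [hcr]) (hg 0).continuousAt
  have hlc : Filter.Tendsto (fun s : ℝ => x₀ + s • w) (𝓝 0) (𝓝 x₀) := by
    simpa using (hl 0).continuousAt.tendsto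
  have hev : ∀ᶠ s : ℝ in 𝓝 0, s = 0 := by
    filter_upwards [hmin, hlc.eventually hmax] with s h1 h2
    have h3 : g 0 ≤ g s := h1
    have h4 : φ (x₀ + s • w) ≤ φ x₀ := h2
    simp only [g, zero_smul, add_zero] at h3
    by_contra hs
    have : 0 < s ^ 2 := by positivity
    nlinarith
  obtain ⟨ε, hε, hball⟩ := Metric.eventually_nhds_iff.1 hev
  have := hball (y := ε / 2) (by simp [abs_of_pos hε, hε])
  linarith

end Radial

/-! ### Viscosity supersolutions: testing and comparison -/

section Viscosity

variable {N k : ℕ} {p : ℝ}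

local notation "E" => EuclideanSpace ℝ (Fin N)

/-- A function which is `C²` at a point agrees near that point with a `C²` function on the whole
space, so that it may serve as a test function. -/
theorem exists_contDiff_eventuallyEq {φ : E → ℝ} {x₀ : E} (hφ : ContDiffAt ℝ 2 φ x₀) :
    ∃ ψ : E → ℝ, ContDiff ℝ 2 ψ ∧ ψ =ᶠ[𝓝 x₀] φ := by
  have hev : ∀ᶠ x in 𝓝 x₀, ContDiffAt ℝ 2 φ x := hφ.eventually (by simp)
  obtain ⟨r, hr, hball⟩ := Metric.eventually_nhds_iff.1 hev
  let f : ContDiffBump x₀ := ⟨r / 3, r / 2, by positivity, by linarith⟩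
  refine ⟨fun x => f x * φ x, contDiff_iff_contDiffAt.2 fun x => ?_, ?_⟩
  · by_cases hx : dist x x₀ < r
    · exact f.contDiff.contDiffAt.mul (hball hx)
    · have hx' : x ∉ tsupport f := by
        rw [f.tsupport_eq, Metric.mem_closedBall, not_le]
        change r / 2 < _
        linarith
      have h0 : (fun x => f x * φ x) =ᶠ[𝓝 x] fun _ => (0 : ℝ) := by
        filter_upwards [notMem_tsupport_iff_eventuallyEq.1 hx'] with z hz
        simp [hz]
      exact contDiffAt_const.congr_of_eventuallyEq h0
  · filter_upwards [f.eventuallyEq_one] with x hx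
    simp [hx]

/-- Testing a viscosity supersolution from below with a function of `|x - y|²`, up to an additive
constant. -/
theorem IsViscositySupersolution.radial_test (hk : 0 < k) (hkN : k < N) {u : E → ℝ}
    (hu : IsViscositySupersolution k p u) {h h1 : ℝ → ℝ} {h2 : ℝ} (y x₀ : E)
    (hC : ContDiffAt ℝ 2 h (‖x₀ - y‖ ^ 2))
    (hh : ∀ᶠ s in 𝓝 (‖x₀ - y‖ ^ 2), HasDerivAt h (h1 s) s)
    (hh1 : HasDerivAt h1 h2 (‖x₀ - y‖ ^ 2))
    (hmin : IsLocalMin (fun x => u x - h (‖x - y‖ ^ 2)) x₀) :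
    2 * k * h1 (‖x₀ - y‖ ^ 2) + 4 * ‖x₀ - y‖ ^ 2 * max h2 0 + u x₀ ^ p ≤ 0 := by
  set c := u x₀ - h (‖x₀ - y‖ ^ 2) with hc
  have hφ : ContDiffAt ℝ 2 (fun x : E => h (‖x - y‖ ^ 2) + c) x₀ := by
    have h1 : ContDiffAt ℝ 2 (fun x : E => ‖x - y‖ ^ 2) x₀ :=
      ((contDiff_id.sub contDiff_const).norm_sq ℝ).contDiffAt
    exact (ContDiffAt.comp x₀ hC h1).add contDiffAt_const
  obtain ⟨ψ, hψ, hψφ⟩ := exists_contDiff_eventuallyEq hφ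
  have key := hu.2 ψ hψ x₀ (by rw [hψφ.self_of_nhds, hc]; ring) (by
    filter_upwards [hψφ, hmin] with x hx1 hx2
    rw [hx1]
    linarith)
  rwa [Pplus_hessian_comp_normSq_sub hk hkN (h := fun s => h s + c) (h1 := h1) y x₀ _ hψφ
    (hh.mono fun s hs => hs.add_const c) hh1] at key

/-- Comparison in the exterior of a ball: a viscosity supersolution `u ≥ 0` stays above
`h(|x - y|²)` on `|x - y| ≥ ρ` if it does so for `|x - y| = ρ`, if `h` vanishes at infinity, and
if `h(|x - y|²)` is a strict subsolution of the equation with right-hand side `-uᵖ`. -/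
theorem IsViscositySupersolution.le_of_exterior (hk : 0 < k) (hkN : k < N) {u : E → ℝ}
    (hu0 : ∀ x, 0 ≤ u x) (hu : IsViscositySupersolution k p u) {h h1 h2 : ℝ → ℝ} (y : E) {ρ : ℝ}
    (hρ : 0 < ρ) (hC : ∀ t, ρ ^ 2 ≤ t → ContDiffAt ℝ 2 h t)
    (hh : ∀ t, ρ ^ 2 < t → HasDerivAt h (h1 t) t)
    (hh1 : ∀ t, ρ ^ 2 < t → HasDerivAt h1 (h2 t) t)
    (hlim : Filter.Tendsto h Filter.atTop (𝓝 0))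
    (hbd : ∀ x, ‖x - y‖ = ρ → h (ρ ^ 2) ≤ u x)
    (hsub : ∀ x, ρ < ‖x - y‖ →
      0 < 2 * k * h1 (‖x - y‖ ^ 2) + 4 * ‖x - y‖ ^ 2 * h2 (‖x - y‖ ^ 2) + u x ^ p)
    (x : E) (hx : ρ ≤ ‖x - y‖) : h (‖x - y‖ ^ 2) ≤ u x := by
  by_contra hlt
  push Not at hlt
  set η := h (‖x - y‖ ^ 2) - u x with hη
  have hηpos : 0 < η := by linarith
  -- Far away `h < η`, so that the minimum of `u - h(|· - y|²)` is attained at a bounded distance.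
  obtain ⟨T, hT⟩ := Filter.eventually_atTop.1 (hlim.eventually_lt_const hηpos)
  obtain ⟨R, hR1, hRT⟩ : ∃ R, ‖x - y‖ < R ∧ T ≤ R ^ 2 := by
    refine ⟨‖x - y‖ + 1 + |T|, by linarith [abs_nonneg T], ?_⟩
    have h1 := le_abs_self T
    have h2 := abs_nonneg T
    have h3 := norm_nonneg (x - y)
    nlinarith
  let K : Set E := Metric.closedBall y R ∩ {z | ρ ≤ ‖z - y‖}
  have hcn : Continuous fun z : E => ‖z - y‖ := by fun_prop
  have hK : IsCompact K :=
    (isCompact_closedBall y R).inter_right (isClosed_le continuous_const hcn)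
  have hxK : x ∈ K := ⟨by rw [Metric.mem_closedBall, dist_eq_norm]; exact hR1.le, hx⟩
  have hlsc : LowerSemicontinuousOn (fun z => u z + -h (‖z - y‖ ^ 2)) K := by
    refine LowerSemicontinuousOn.add (hu.1.lowerSemicontinuousOn K)
      (ContinuousOn.lowerSemicontinuousOn ?_)
    intro z hz
    have hz2 : ρ ^ 2 ≤ ‖z - y‖ ^ 2 := pow_le_pow_left₀ hρ.le hz.2 2
    have h1 : ContinuousAt (fun z : E => ‖z - y‖ ^ 2) z := by fun_prop
    exact (ContinuousAt.comp (f := fun z : E => ‖z - y‖ ^ 2)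
      (hC _ hz2).continuousAt h1).neg.continuousWithinAt
  obtain ⟨x₀, hx₀K, hx₀min⟩ := hlsc.exists_isMinOn ⟨x, hxK⟩ hK
  have hval : u x₀ + -h (‖x₀ - y‖ ^ 2) ≤ -η := by
    have := hx₀min hxK
    simp only [Set.mem_ofPred_eq] at this
    linarith
  have hρ₀ : ρ < ‖x₀ - y‖ := by
    refine lt_of_le_of_ne hx₀K.2 fun heq => ?_
    have := hbd x₀ heq.symm
    rw [← heq] at hval
    linarith
  have hR₀ : ‖x₀ - y‖ < R := by
    have hle : ‖x₀ - y‖ ≤ R := by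
      have := hx₀K.1
      rwa [Metric.mem_closedBall, dist_eq_norm] at this
    refine lt_of_le_of_ne hle fun heq => ?_
    have := hT (‖x₀ - y‖ ^ 2) (by rw [heq]; exact hRT)
    linarith [hu0 x₀]
  have ht : ρ ^ 2 < ‖x₀ - y‖ ^ 2 := pow_lt_pow_left₀ hρ₀ hρ.le (by norm_num)
  have hmin : IsLocalMin (fun z => u z - h (‖z - y‖ ^ 2)) x₀ := by
    filter_upwards [hcn.continuousAt.eventually_lt_const hR₀,
      hcn.continuousAt.eventually_const_lt hρ₀] with z hz1 hz2
    have := hx₀min (show z ∈ K from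
      ⟨by rw [Metric.mem_closedBall, dist_eq_norm]; exact hz1.le, hz2.le⟩)
    simp only [Set.mem_ofPred_eq] at this
    linarith
  have key := hu.radial_test hk hkN y x₀ (hC _ ht.le)
    (Filter.eventually_of_mem (Ioi_mem_nhds ht) fun s hs => hh s hs) (hh1 _ ht) hmin
  have h3 := hsub x₀ hρ₀
  have h4 : 4 * ‖x₀ - y‖ ^ 2 * h2 (‖x₀ - y‖ ^ 2) ≤
      4 * ‖x₀ - y‖ ^ 2 * max (h2 (‖x₀ - y‖ ^ 2)) 0 :=
    mul_le_mul_of_nonneg_left (le_max_left _ _) (by positivity)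
  linarith

end Viscosity

/-! ### The Liouville property of viscosity supersolutions -/

section Liouville

variable {N k : ℕ} {p : ℝ}

local notation "E" => EuclideanSpace ℝ (Fin N)

/-- Comparison with `(|x - y|² - ρ²/2)^(1 - k/2)`. The shift by `ρ²/2` makes this variant of the
fundamental solution a strict subsolution. -/
theorem IsViscositySupersolution.lower_bound (hk : 2 < k) (hkN : k < N) {u : E → ℝ}
    (hu0 : ∀ x, 0 ≤ u x) (hu : IsViscositySupersolution k p u) (y : E) {ρ δ : ℝ}
    (hρ : 0 < ρ) (hδ : 0 < δ) (hbd : ∀ x, ‖x - y‖ ≤ ρ → δ ≤ u x) (x : E) (hx : ρ ≤ ‖x - y‖) :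
    δ * (ρ ^ 2 / 2) ^ ((k : ℝ) / 2 - 1) * (‖x - y‖ ^ 2 - ρ ^ 2 / 2) ^ (-((k : ℝ) / 2 - 1)) ≤
      u x := by
  set a : ℝ := (k : ℝ) / 2 - 1 with ha
  have hka : (k : ℝ) = 2 * (a + 1) := by rw [ha]; ring
  have ha0 : 0 < a := by
    have : (2 : ℝ) < k := by exact_mod_cast hk
    rw [ha]; linarith
  set ε : ℝ := ρ ^ 2 / 2 with hε
  have hε0 : 0 < ε := by positivity
  have hρε : ρ ^ 2 = 2 * ε := by rw [hε]; ring
  set A : ℝ := δ * ε ^ a with hA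
  have hA0 : 0 < A := by positivity
  have hsub : ∀ t, HasDerivAt (fun t : ℝ => t - ε) 1 t := fun t => (hasDerivAt_id t).sub_const ε
  refine hu.le_of_exterior (by omega) hkN hu0 (h := fun t => A * (t - ε) ^ (-a))
    (h1 := fun t => -(a * A) * (t - ε) ^ (-a - 1))
    (h2 := fun t => a * (a + 1) * A * (t - ε) ^ (-a - 2)) y hρ ?_ ?_ ?_ ?_ ?_ ?_ x hx
  · intro t ht
    have : t - ε ≠ 0 := by linarith
    exact contDiffAt_const.mul ((contDiffAt_id.sub contDiffAt_const).rpow_const_of_ne this)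
  · intro t ht
    have : t - ε ≠ 0 := by linarith
    refine (((hsub t).rpow_const (Or.inl this)).const_mul A).congr_deriv ?_
    ring
  · intro t ht
    have : t - ε ≠ 0 := by linarith
    refine (((hsub t).rpow_const (p := -a - 1) (Or.inl this)).const_mul (-(a * A))).congr_deriv ?_
    rw [show -a - 1 - 1 = -a - 2 by ring]
    ring
  · have h1 : Filter.Tendsto (fun t : ℝ => t - ε) Filter.atTop Filter.atTop :=
      Filter.tendsto_atTop_add_const_right _ (-ε) Filter.tendsto_id
    simpa using ((tendsto_rpow_neg_atTop ha0).comp h1).const_mul A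
  · intro z hz
    have h1 : A * (ρ ^ 2 - ε) ^ (-a) = δ := by
      rw [show ρ ^ 2 - ε = ε by linarith, hA, mul_assoc, ← Real.rpow_add hε0]
      simp
    simpa only [h1] using hbd z hz.le
  · intro z hz
    have ht : ρ ^ 2 < ‖z - y‖ ^ 2 := pow_lt_pow_left₀ hz hρ.le (by norm_num)
    set t := ‖z - y‖ ^ 2
    have hpos : 0 < t - ε := by linarith
    have h1 : (t - ε) ^ (-a - 1) = (t - ε) ^ (-a - 2) * (t - ε) := by
      rw [← Real.rpow_add_one hpos.ne']
      congr 1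
      ring
    have h2 : 0 < (t - ε) ^ (-a - 2) := Real.rpow_pos_of_pos hpos _
    have h3 : 0 ≤ u z ^ p := Real.rpow_nonneg (hu0 z) p
    have h4 : 2 * (k : ℝ) * (-(a * A) * (t - ε) ^ (-a - 1)) +
        4 * t * (a * (a + 1) * A * (t - ε) ^ (-a - 2)) =
        4 * a * (a + 1) * A * ε * (t - ε) ^ (-a - 2) := by
      rw [h1, hka]
      ring
    have h5 : 0 < 4 * a * (a + 1) * A * ε * (t - ε) ^ (-a - 2) := by positivity
    linarith

/-- Comparison with `κ t^(1 - k/2) log t`, `t = |x - y|²`. The summand `1 / (k/2 - 1)` makes the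
comparison function decreasing in `t ≥ 1`, so that its value at `t = R²` bounds `u` from below on
the whole ball of radius `R`. -/
theorem IsViscositySupersolution.log_lower_bound (hk : 2 < k) (hkN : k < N) (hp : 0 < p)
    (hpk : p ≤ (k : ℝ) / (k - 2)) {u : E → ℝ}
    (hu0 : ∀ x, 0 ≤ u x) (hu : IsViscositySupersolution k p u) (y : E) {c : ℝ} (hc : 0 < c)
    (hbd : ∀ x, ‖x - y‖ ≤ 1 → c ≤ u x) :
    ∃ κ > 0, ∀ R, 1 ≤ R → ∀ x, ‖x - y‖ ≤ R →
      κ * (R ^ 2) ^ (-((k : ℝ) / 2 - 1)) * (1 / ((k : ℝ) / 2 - 1) + Real.log (R ^ 2)) ≤ u x := by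
  set a : ℝ := (k : ℝ) / 2 - 1 with ha
  have hka : (k : ℝ) = 2 * (a + 1) := by rw [ha]; ring
  have ha0 : 0 < a := by
    have : (2 : ℝ) < k := by exact_mod_cast hk
    rw [ha]; linarith
  have hap : a * p ≤ a + 1 := by
    rw [hka, show 2 * (a + 1) - 2 = 2 * a by ring, le_div_iff₀ (by positivity)] at hpk
    linarith
  set c' : ℝ := c * (1 / 2) ^ a with hc'
  have hc'0 : 0 < c' := by positivity
  have hlow : ∀ x, 1 ≤ ‖x - y‖ → c' * (‖x - y‖ ^ 2) ^ (-a) ≤ u x := by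
    intro x hx
    have h1 := hu.lower_bound hk hkN hu0 y one_pos hc hbd x hx
    have ht : 1 ≤ ‖x - y‖ ^ 2 := one_le_pow₀ hx
    refine le_trans ?_ h1
    rw [one_pow, ← ha, hc']
    refine mul_le_mul_of_nonneg_left ?_ (by positivity)
    exact Real.rpow_le_rpow_of_nonpos (by linarith) (by linarith) (by linarith)
  -- `κ ≤ a c` gives the boundary inequality, `4 a κ < c' ^ p` the differential one.
  set κ : ℝ := min (a * c) (c' ^ p / (8 * a)) with hκ
  have hκ0 : 0 < κ := by
    have : 0 < c' ^ p := Real.rpow_pos_of_pos hc'0 p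
    rw [hκ]
    positivity
  have hκ1 : κ ≤ a * c := min_le_left _ _
  have hκ2 : 4 * a * κ < c' ^ p := by
    have h1 : κ ≤ c' ^ p / (8 * a) := min_le_right _ _
    rw [le_div_iff₀ (by positivity)] at h1
    have : 0 < a * κ := by positivity
    linarith
  let h : ℝ → ℝ := fun t => κ * (t ^ (-a) * (1 / a + Real.log t))
  let h1 : ℝ → ℝ := fun t => κ * (t ^ (-a - 1) * (-a * Real.log t))
  have hh : ∀ t, 0 < t → HasDerivAt h (h1 t) t := by
    intro t ht
    have e1 := (hasDerivAt_id t).rpow_const (p := -a) (Or.inl ht.ne')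
    have e2 := (Real.hasDerivAt_log ht.ne').const_add (1 / a)
    refine ((e1.mul e2).const_mul κ).congr_deriv ?_
    have e3 : t ^ (-a) = t ^ (-a - 1) * t := by
      rw [← Real.rpow_add_one ht.ne']
      congr 1
      ring
    simp only [h1, id_eq, e3]
    field_simp
    ring
  have hcomp : ∀ x, 1 ≤ ‖x - y‖ → h (‖x - y‖ ^ 2) ≤ u x := by
    refine hu.le_of_exterior (by omega) hkN hu0 (h := h) (h1 := h1)
      (h2 := fun t => κ * (t ^ (-a - 2) * (a * (a + 1) * Real.log t - a))) y one_pos ?_ ?_ ?_ ?_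
      ?_ ?_
    · intro t ht
      have : t ≠ 0 := by linarith
      exact contDiffAt_const.mul ((contDiffAt_id.rpow_const_of_ne this).mul
        (contDiffAt_const.add (Real.contDiffAt_log.2 this)))
    · intro t ht
      exact hh t (by linarith)
    · intro t ht
      have ht0 : 0 < t := by linarith
      have e1 := (hasDerivAt_id t).rpow_const (p := -a - 1) (Or.inl ht0.ne')
      have e2 := (Real.hasDerivAt_log ht0.ne').const_mul (-a)
      refine ((e1.mul e2).const_mul κ).congr_deriv ?_
      have e3 : t ^ (-a - 1) = t ^ (-a - 2) * t := by
        rw [← Real.rpow_add_one ht0.ne']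
        congr 1
        ring
      simp only [id_eq]
      rw [show -a - 1 - 1 = -a - 2 by ring, e3]
      field_simp
      ring
    · have e1 := (tendsto_rpow_neg_atTop ha0).mul_const (1 / a)
      have e2 := (isLittleO_log_rpow_atTop ha0).tendsto_div_nhds_zero
      have e3 := (e1.add e2).const_mul κ
      simp only [zero_mul, add_zero, mul_zero] at e3
      refine e3.congr' ?_
      filter_upwards [Filter.eventually_gt_atTop (0 : ℝ)] with t ht
      simp only [h]
      rw [Real.rpow_neg ht.le]
      ring
    · intro z hz
      refine le_trans ?_ (hbd z hz.le)
      simp only [h, one_pow, Real.one_rpow, Real.log_one, add_zero, one_mul]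
      rw [mul_one_div, div_le_iff₀ ha0]
      linarith
    · intro z hz
      have ht : 1 < ‖z - y‖ ^ 2 := one_lt_pow₀ hz (by norm_num)
      have hz1 := hlow z hz.le
      set t := ‖z - y‖ ^ 2
      have ht0 : 0 < t := by linarith
      have e1 : t ^ (-a - 1) = t ^ (-a - 2) * t := by
        rw [← Real.rpow_add_one ht0.ne']
        congr 1
        ring
      have e2 : 2 * (k : ℝ) * h1 t +
          4 * t * (κ * (t ^ (-a - 2) * (a * (a + 1) * Real.log t - a))) =
          -(4 * a * κ) * t ^ (-a - 1) := by
        simp only [h1]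
        rw [e1, hka]
        ring
      have e3 : c' ^ p * t ^ (-a - 1) ≤ u z ^ p := by
        calc c' ^ p * t ^ (-a - 1) ≤ c' ^ p * t ^ (-a * p) := by
              refine mul_le_mul_of_nonneg_left ?_ (by positivity)
              exact Real.rpow_le_rpow_of_exponent_le ht.le (by linarith)
          _ = (c' * t ^ (-a)) ^ p := by
              rw [Real.mul_rpow hc'0.le (by positivity), Real.rpow_mul ht0.le]
          _ ≤ u z ^ p := Real.rpow_le_rpow (by positivity) hz1 hp.le
      have e4 : 0 < t ^ (-a - 1) := Real.rpow_pos_of_pos ht0 _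
      nlinarith
  have hanti : AntitoneOn h (Set.Ici 1) := by
    refine antitoneOn_of_deriv_nonpos (convex_Ici 1) ?_ ?_ ?_
    · intro t ht
      exact (hh t (by linarith [Set.mem_Ici.1 ht])).continuousAt.continuousWithinAt
    · intro t ht
      rw [interior_Ici] at ht
      exact (hh t (by linarith [Set.mem_Ioi.1 ht])).differentiableAt.differentiableWithinAt
    · intro t ht
      rw [interior_Ici] at ht
      have ht1 : 1 < t := ht
      rw [(hh t (by linarith)).deriv]
      have e1 : 0 < t ^ (-a - 1) := Real.rpow_pos_of_pos (by linarith) _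
      have e2 : 0 ≤ Real.log t := Real.log_nonneg ht1.le
      have e3 : 0 ≤ κ * (t ^ (-a - 1) * (a * Real.log t)) := by positivity
      simp only [h1]
      linarith
  refine ⟨κ, hκ0, fun R hR x hx => ?_⟩
  have hR2 : 1 ≤ R ^ 2 := one_le_pow₀ hR
  rw [mul_assoc]
  change h (R ^ 2) ≤ u x
  rcases le_total ‖x - y‖ 1 with hx1 | hx1
  · calc h (R ^ 2) ≤ h 1 := hanti (by simp) hR2 hR2
      _ ≤ c := by
        simp only [h, Real.one_rpow, Real.log_one, add_zero, one_mul]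
        rw [mul_one_div, div_le_iff₀ ha0]
        linarith
      _ ≤ u x := hbd x hx1
  · have e1 : 1 ≤ ‖x - y‖ ^ 2 := one_le_pow₀ hx1
    exact (hanti e1 hR2 (pow_le_pow_left₀ (by linarith) hx 2)).trans (hcomp x hx1)

/-- A nonnegative supersolution that is positive at one point is bounded below by a positive
constant on the unit ball around it. -/
theorem IsViscositySupersolution.exists_pos_le (hk : 2 < k) (hkN : k < N) {u : E → ℝ}
    (hu0 : ∀ x, 0 ≤ u x) (hu : IsViscositySupersolution k p u) {y : E} (hy : 0 < u y) :
    ∃ c > 0, ∀ x, ‖x - y‖ ≤ 1 → c ≤ u x := by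
  have ha0 : 0 < (k : ℝ) / 2 - 1 := by
    have : (2 : ℝ) < k := by exact_mod_cast hk
    linarith
  obtain ⟨r, hr, hball⟩ := Metric.eventually_nhds_iff.1 (hu.1 y (u y / 2) (by linarith))
  have hbd : ∀ x, ‖x - y‖ ≤ r / 2 → u y / 2 ≤ u x := fun x hx =>
    (hball (by rw [dist_eq_norm]; linarith)).le
  set ρ := r / 2 with hρ
  have hρ0 : 0 < ρ := by positivity
  refine ⟨min (u y / 2) (u y / 2 * (ρ ^ 2 / 2) ^ ((k : ℝ) / 2 - 1)), by positivity,
    fun x hx => ?_⟩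
  rcases le_total ‖x - y‖ ρ with h | h
  · exact (min_le_left _ _).trans (hbd x h)
  · refine (min_le_right _ _).trans
      (le_trans ?_ (hu.lower_bound hk hkN hu0 y hρ0 (half_pos hy) hbd x h))
    refine le_mul_of_one_le_right (by positivity) ?_
    have h1 : ρ ^ 2 ≤ ‖x - y‖ ^ 2 := pow_le_pow_left₀ hρ0.le h 2
    have h2 : ‖x - y‖ ^ 2 ≤ 1 := pow_le_one₀ (norm_nonneg _) hx
    have h3 : 0 < ρ ^ 2 := by positivity
    exact Real.one_le_rpow_of_pos_of_le_one_of_nonpos (by linarith) (by linarith) (by linarith)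

/-- The minimum `m` of `u` over a ball of radius `R` satisfies `mᵖ ≤ C m / R²`: test with a
paraboloid vanishing on the sphere of radius `2R`, and use that the minimum over the ball of radius
`2R` is comparable with `m`. -/
theorem IsViscositySupersolution.min_rpow_le (hk : 2 < k) (hkN : k < N) (hp : 0 < p) {u : E → ℝ}
    (hu0 : ∀ x, 0 ≤ u x) (hu : IsViscositySupersolution k p u) (y : E) {R m : ℝ} (hR : 0 < R)
    (hm : 0 < m) (hmin : ∀ x, ‖x - y‖ ≤ R → m ≤ u x) (hatt : ∃ z, ‖z - y‖ ≤ R ∧ u z = m) :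
    R ^ 2 * m ^ (p - 1) ≤ k / ((1 / 8 : ℝ) ^ ((k : ℝ) / 2 - 1)) ^ p := by
  set a : ℝ := (k : ℝ) / 2 - 1 with ha
  have ha0 : 0 < a := by
    have : (2 : ℝ) < k := by exact_mod_cast hk
    rw [ha]; linarith
  set b : ℝ := 2 * m / (4 * R ^ 2) with hb
  have hb0 : 0 < b := by positivity
  have hbR : b * R ^ 2 = m / 2 := by
    rw [hb]
    field_simp
    ring
  let h : ℝ → ℝ := fun t => 2 * m - b * t
  have hh : ∀ t, HasDerivAt h (-b) t := fun t => by
    refine (((hasDerivAt_id t).const_mul b).const_sub (2 * m)).congr_deriv ?_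
    ring
  have hhC : ContDiff ℝ 2 h := contDiff_const.sub (contDiff_const.mul contDiff_id)
  have hlsc : LowerSemicontinuousOn (fun z => u z + -h (‖z - y‖ ^ 2))
      (Metric.closedBall y (2 * R)) := by
    refine LowerSemicontinuousOn.add (hu.1.lowerSemicontinuousOn _)
      (Continuous.continuousOn ?_).lowerSemicontinuousOn
    simp only [h]
    fun_prop
  obtain ⟨z, hzR, hz⟩ := hatt
  have hzK : z ∈ Metric.closedBall y (2 * R) := by
    rw [Metric.mem_closedBall, dist_eq_norm]; linarith
  obtain ⟨x₀, hx₀K, hx₀min⟩ := hlsc.exists_isMinOn ⟨z, hzK⟩ (isCompact_closedBall y (2 * R))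
  have hneg : u x₀ < h (‖x₀ - y‖ ^ 2) := by
    have h1 := hx₀min hzK
    simp only [Set.mem_ofPred_eq] at h1
    have h2 : ‖z - y‖ ^ 2 ≤ R ^ 2 := pow_le_pow_left₀ (norm_nonneg _) hzR 2
    have h3 : b * ‖z - y‖ ^ 2 ≤ m / 2 := hbR ▸ mul_le_mul_of_nonneg_left h2 hb0.le
    have h4 : h (‖z - y‖ ^ 2) = 2 * m - b * ‖z - y‖ ^ 2 := rfl
    linarith
  have hx₀ : ‖x₀ - y‖ < 2 * R := by
    have hle : ‖x₀ - y‖ ≤ 2 * R := by rwa [Metric.mem_closedBall, dist_eq_norm] at hx₀K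
    refine lt_of_le_of_ne hle fun heq => ?_
    have h1 : h (‖x₀ - y‖ ^ 2) = 2 * m - b * (2 * R) ^ 2 := by rw [heq]
    have h2 := hu0 x₀
    have h3 : b * (2 * R) ^ 2 = 4 * (b * R ^ 2) := by ring
    rw [hbR] at h3
    linarith
  have hcn : Continuous fun z : E => ‖z - y‖ := by fun_prop
  have hloc : IsLocalMin (fun z => u z - h (‖z - y‖ ^ 2)) x₀ := by
    filter_upwards [hcn.continuousAt.eventually_lt_const hx₀] with w hw
    have := hx₀min (show w ∈ Metric.closedBall y (2 * R) by
      rw [Metric.mem_closedBall, dist_eq_norm]; exact hw.le)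
    simp only [Set.mem_ofPred_eq] at this
    linarith
  have key := hu.radial_test (by omega) hkN y x₀ hhC.contDiffAt
    (Filter.Eventually.of_forall hh) (hasDerivAt_const _ _) hloc
  simp only [max_self, mul_zero, add_zero] at key
  have hux₀ : m * (1 / 8 : ℝ) ^ a ≤ u x₀ := by
    rcases le_total ‖x₀ - y‖ R with h1 | h1
    · refine le_trans ?_ (hmin x₀ h1)
      exact mul_le_of_le_one_right hm.le
        (Real.rpow_le_one (by norm_num) (by norm_num) ha0.le)
    · refine le_trans ?_ (hu.lower_bound hk hkN hu0 y hR hm hmin x₀ h1)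
      have h2 : ‖x₀ - y‖ ^ 2 ≤ (2 * R) ^ 2 := pow_le_pow_left₀ (norm_nonneg _) hx₀.le 2
      have h3 : R ^ 2 ≤ ‖x₀ - y‖ ^ 2 := pow_le_pow_left₀ hR.le h1 2
      have h4 : 0 < R ^ 2 := by positivity
      have h5 : (1 / 8 : ℝ) ^ a = (R ^ 2 / 2) ^ a * (4 * R ^ 2) ^ (-a) := by
        rw [Real.rpow_neg (by positivity), ← div_eq_mul_inv,
          ← Real.div_rpow (by positivity) (by positivity)]
        congr 1
        field_simp
        norm_num
      rw [← ha, h5, mul_assoc]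
      refine mul_le_mul_of_nonneg_left (mul_le_mul_of_nonneg_left ?_ (by positivity)) hm.le
      exact Real.rpow_le_rpow_of_nonpos (by linarith) (by nlinarith) (by linarith)
  have hpow : m ^ p * ((1 / 8 : ℝ) ^ a) ^ p ≤ u x₀ ^ p := by
    rw [← Real.mul_rpow hm.le (by positivity)]
    exact Real.rpow_le_rpow (by positivity) hux₀ hp.le
  have hm1 : m ^ p = m ^ (p - 1) * m := by
    rw [← Real.rpow_add_one hm.ne']
    congr 1
    ring
  rw [hm1] at hpow
  have h6 : R ^ 2 * (m ^ (p - 1) * m * ((1 / 8 : ℝ) ^ a) ^ p) ≤ k * m := by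
    have h7 : m ^ (p - 1) * m * ((1 / 8 : ℝ) ^ a) ^ p ≤ 2 * k * b := by linarith
    calc _ ≤ R ^ 2 * (2 * k * b) := mul_le_mul_of_nonneg_left h7 (by positivity)
      _ = 2 * k * (b * R ^ 2) := by ring
      _ = k * m := by rw [hbR]; ring
  rw [le_div_iff₀ (by positivity)]
  refine le_of_mul_le_mul_right ?_ hm
  linarith

theorem IsViscositySupersolution.eq_zero (hk : 2 < k) (hkN : k < N) (hp : 0 < p)
    (hpk : p ≤ (k : ℝ) / (k - 2)) {u : E → ℝ} (hu0 : ∀ x, 0 ≤ u x)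
    (hu : IsViscositySupersolution k p u) (y : E) : u y = 0 := by
  by_contra hy
  have hypos : 0 < u y := lt_of_le_of_ne (hu0 y) (Ne.symm hy)
  obtain ⟨c, hc, hbd⟩ := hu.exists_pos_le hk hkN hu0 hypos
  obtain ⟨κ, hκ, hlow⟩ := hu.log_lower_bound hk hkN hp hpk hu0 y hc hbd
  set a : ℝ := (k : ℝ) / 2 - 1 with ha
  have hka : (k : ℝ) = 2 * (a + 1) := by rw [ha]; ring
  have ha0 : 0 < a := by
    have : (2 : ℝ) < k := by exact_mod_cast hk
    rw [ha]; linarith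
  have hap : a * p ≤ a + 1 := by
    rw [hka, show 2 * (a + 1) - 2 = 2 * a by ring, le_div_iff₀ (by positivity)] at hpk
    linarith
  set C : ℝ := k / ((1 / 8 : ℝ) ^ a) ^ p
  have key : ∀ R, 1 ≤ R → ∃ m, κ * (R ^ 2) ^ (-a) * (1 / a + Real.log (R ^ 2)) ≤ m ∧ m ≤ u y ∧
      0 < m ∧ R ^ 2 * m ^ (p - 1) ≤ C := by
    intro R hR
    obtain ⟨z, hzK, hz⟩ := (hu.1.lowerSemicontinuousOn (Metric.closedBall y R)).exists_isMinOn
      ⟨y, by simp; linarith⟩ (isCompact_closedBall y R)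
    have hzR : ‖z - y‖ ≤ R := by rwa [Metric.mem_closedBall, dist_eq_norm] at hzK
    have h1 := hlow R hR z hzR
    have hR2 : 1 ≤ R ^ 2 := one_le_pow₀ hR
    have h2 : 0 ≤ Real.log (R ^ 2) := Real.log_nonneg hR2
    have h3 : 0 < κ * (R ^ 2) ^ (-a) * (1 / a + Real.log (R ^ 2)) := by positivity
    have hmin : ∀ x, ‖x - y‖ ≤ R → u z ≤ u x := fun x hx =>
      hz (show x ∈ Metric.closedBall y R by rwa [Metric.mem_closedBall, dist_eq_norm])
    exact ⟨u z, h1, hmin y (by simp; linarith), by linarith,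
      hu.min_rpow_le hk hkN hp hu0 y (by linarith) (by linarith) hmin ⟨z, hzR, rfl⟩⟩
  rcases le_or_gt p 1 with hp1 | hp1
  · -- For `p ≤ 1` it suffices that the minima are bounded above.
    have h1 : 0 < u y ^ (p - 1) := Real.rpow_pos_of_pos hypos _
    have hT : Filter.Tendsto (fun R : ℝ => R ^ 2 * u y ^ (p - 1)) Filter.atTop Filter.atTop :=
      (Filter.tendsto_pow_atTop (by norm_num)).atTop_mul_const h1
    obtain ⟨R, hR1, hR2⟩ := ((hT.eventually_gt_atTop C).and
      (Filter.eventually_ge_atTop (1 : ℝ))).exists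
    obtain ⟨m, -, hmu, hm0, hm⟩ := key R hR2
    have h2 : u y ^ (p - 1) ≤ m ^ (p - 1) :=
      Real.rpow_le_rpow_of_nonpos hm0 hmu (by linarith)
    have h3 : R ^ 2 * u y ^ (p - 1) ≤ R ^ 2 * m ^ (p - 1) :=
      mul_le_mul_of_nonneg_left h2 (by positivity)
    linarith
  · -- For `p > 1` the logarithm in the lower bound is decisive in the critical case.
    have hp1' : 0 < p - 1 := by linarith
    have hT : Filter.Tendsto (fun R : ℝ => (κ * Real.log (R ^ 2)) ^ (p - 1))
        Filter.atTop Filter.atTop :=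
      (tendsto_rpow_atTop hp1').comp
        ((Real.tendsto_log_atTop.comp (Filter.tendsto_pow_atTop (by norm_num))).const_mul_atTop hκ)
    obtain ⟨R, hR1, hR2⟩ := ((hT.eventually_gt_atTop C).and
      (Filter.eventually_ge_atTop (1 : ℝ))).exists
    obtain ⟨m, hml, -, hm0, hm⟩ := key R hR2
    have ht : 1 ≤ R ^ 2 := one_le_pow₀ hR2
    set t := R ^ 2
    have hlog : 0 ≤ Real.log t := Real.log_nonneg ht
    have ht0 : 0 < t := by linarith
    have h1 : (κ * Real.log t) * t ^ (-a) ≤ m := by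
      refine le_trans ?_ hml
      have : 0 ≤ κ * t ^ (-a) * (1 / a) := by positivity
      linarith
    have h2 : ((κ * Real.log t) * t ^ (-a)) ^ (p - 1) ≤ m ^ (p - 1) :=
      Real.rpow_le_rpow (by positivity) h1 hp1'.le
    rw [Real.mul_rpow (by positivity) (by positivity), ← Real.rpow_mul ht0.le] at h2
    have h3 : 1 ≤ t * t ^ (-a * (p - 1)) := by
      rw [mul_comm, ← Real.rpow_add_one ht0.ne']
      exact Real.one_le_rpow ht (by linarith)
    have h4 : (κ * Real.log t) ^ (p - 1) ≤
        t * ((κ * Real.log t) ^ (p - 1) * t ^ (-a * (p - 1))) := by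
      have : 0 ≤ (κ * Real.log t) ^ (p - 1) := by positivity
      nlinarith
    have h5 : t * ((κ * Real.log t) ^ (p - 1) * t ^ (-a * (p - 1))) ≤ t * m ^ (p - 1) :=
      mul_le_mul_of_nonneg_left h2 ht0.le
    linarith

theorem isViscositySupersolution_zero (hp : 0 < p) {u : E → ℝ} (hu : ∀ x, u x = 0) :
    IsViscositySupersolution k p u := by
  obtain rfl : u = fun _ => 0 := funext hu
  refine ⟨continuous_const.lowerSemicontinuous, fun φ hφ x₀ heq hle => ?_⟩
  have hmax : IsLocalMax φ x₀ := by
    filter_upwards [hle] with x hx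
    rw [heq]
    exact hx
  rw [Real.zero_rpow hp.ne', add_zero]
  exact Pplus_nonpos k _ (dotProduct_hessian_mulVec_nonpos_of_isLocalMax hφ hmax)

end Liouville

/-! ### Positive supersolutions above the exponent `k / (k - 2)` -/

section Supersolution

variable {N k : ℕ} {p : ℝ}

local notation "E" => EuclideanSpace ℝ (Fin N)

theorem exists_pos_isClassicalSupersolution (hk : 2 < k) (hkN : k < N)
    (hp : (k : ℝ) / (k - 2) < p) :
    ∃ u : E → ℝ, (∀ x, 0 < u x) ∧ IsClassicalSupersolution k p u := by
  have hk2 : (2 : ℝ) < k := by exact_mod_cast hk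
  rw [div_lt_iff₀ (by linarith)] at hp
  have hp1 : 0 < p - 1 := by nlinarith
  -- The exponent `b` balances the powers of `1 + t` in the two terms of the equation.
  set b : ℝ := 1 / (p - 1) with hb
  have hb0 : 0 < b := by positivity
  have hbp1 : b * (p - 1) = 1 := by rw [hb]; field_simp
  set d : ℝ := k - 2 - 2 * b with hd
  have hd0 : 0 < d := by
    have h1 : d * (p - 1) = (k - 2) * (p - 1) - 2 := by
      rw [hd]
      linear_combination -2 * hbp1
    have h2 : 0 < d * (p - 1) := by rw [h1]; linarith
    exact pos_of_mul_pos_left h2 hp1.le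
  set A : ℝ := (2 * b * d) ^ b with hA
  have hA0 : 0 < A := by positivity
  have hAp : A ^ p = 2 * b * d * A := by
    have h1 : A ^ (p - 1) = 2 * b * d := by
      rw [hA, ← Real.rpow_mul (by positivity), hbp1, Real.rpow_one]
    rw [← h1, ← Real.rpow_add_one hA0.ne']
    congr 1
    ring
  have hpos : ∀ x : E, 0 < 1 + ‖x - 0‖ ^ 2 := fun x => by positivity
  have hC : ContDiff ℝ 2 fun x : E => A * (1 + ‖x - 0‖ ^ 2) ^ (-b) :=
    contDiff_const.mul
      ((contDiff_const.add ((contDiff_id.sub contDiff_const).norm_sq ℝ)).rpow_const_of_ne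
        fun x => (hpos x).ne')
  refine ⟨_, fun x => ?_, hC, fun x => ?_⟩
  · have := Real.rpow_pos_of_pos (hpos x) (-b)
    positivity
  have hadd : ∀ t : ℝ, HasDerivAt (fun t : ℝ => 1 + t) 1 t := fun t =>
    (hasDerivAt_id t).const_add 1
  have ht0 : 0 ≤ ‖x - 0‖ ^ 2 := by positivity
  have hh : ∀ t : ℝ, -1 < t →
      HasDerivAt (fun t : ℝ => A * (1 + t) ^ (-b)) (-(b * A) * (1 + t) ^ (-b - 1)) t := by
    intro t ht
    have h1 : 1 + t ≠ 0 := by linarith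
    refine (((hadd t).rpow_const (Or.inl h1)).const_mul A).congr_deriv ?_
    ring
  have hh1 : HasDerivAt (fun t : ℝ => -(b * A) * (1 + t) ^ (-b - 1))
      (b * (b + 1) * A * (1 + ‖x - 0‖ ^ 2) ^ (-b - 2)) (‖x - 0‖ ^ 2) := by
    have h1 : 1 + ‖x - 0‖ ^ 2 ≠ 0 := by linarith
    refine (((hadd _).rpow_const (p := -b - 1) (Or.inl h1)).const_mul (-(b * A))).congr_deriv ?_
    rw [show -b - 1 - 1 = -b - 2 by ring]
    ring
  rw [Pplus_hessian_comp_normSq_sub (by omega) hkN (h := fun t => A * (1 + t) ^ (-b)) 0 x _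
    (Filter.EventuallyEq.refl _ _)
    (Filter.eventually_of_mem (Ioi_mem_nhds (show -1 < ‖x - 0‖ ^ 2 by linarith))
      fun s hs => hh s hs) hh1]
  set t := ‖x - 0‖ ^ 2
  have h1t : 0 < 1 + t := by linarith
  have h2 : (1 + t) ^ (-b - 1) = (1 + t) ^ (-b - 2) * (1 + t) := by
    rw [← Real.rpow_add_one h1t.ne']
    congr 1
    ring
  have h3 : (A * (1 + t) ^ (-b)) ^ p = 2 * b * d * A * ((1 + t) ^ (-b - 2) * (1 + t)) := by
    rw [Real.mul_rpow hA0.le (by positivity), hAp, ← Real.rpow_mul h1t.le, ← h2,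
      show -b * p = -b - 1 by linear_combination -hbp1]
  have h4 : 0 < (1 + t) ^ (-b - 2) := Real.rpow_pos_of_pos h1t _
  rw [max_eq_left (by positivity), h2, h3]
  have h5 : 0 ≤ 4 * b * A * (1 + t) ^ (-b - 2) * (b + 1) := by positivity
  rw [hd]
  linarith

end Supersolution

/-! ### The Pohozaev functional of the Lane–Emden equation -/

section Pohozaev

/-- The Pohozaev functional of the Lane–Emden equation `u'' + (2m - 1) u' / r + uᵖ = 0` in
dimension `2m`, for `u(r) = h(r²)`, `h1 = h'` and `t = r²`: it is
`rⁿ u'² / 2 + rⁿ uᵖ⁺¹ / (p + 1) + (n - 2) rⁿ⁻¹ u u' / 2` with `n = 2m`. -/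
def pohozaev (m p : ℝ) (h h1 : ℝ → ℝ) (t : ℝ) : ℝ :=
  t ^ m * (2 * t * h1 t ^ 2 + h t ^ (p + 1) / (p + 1) + (2 * m - 2) * h t * h1 t)

theorem hasDerivAt_pohozaev {m p : ℝ} (hp : 0 < p) {h h1 h2 : ℝ → ℝ} {t : ℝ} (ht : 0 < t)
    (hpos : 0 < h t) (hh : HasDerivAt h (h1 t) t) (hh1 : HasDerivAt h1 (h2 t) t)
    (heq : 4 * t * h2 t + 4 * m * h1 t + h t ^ p = 0) :
    HasDerivAt (pohozaev m p h h1)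
      (t ^ (m - 1) * h t ^ (p + 1) * (m / (p + 1) - (m - 1) / 2)) t := by
  have e1 := (hasDerivAt_id t).rpow_const (p := m) (Or.inl ht.ne')
  have e2 := ((hasDerivAt_id t).const_mul 2).mul (hh1.pow 2)
  have e3 := (hh.rpow_const (p := p + 1) (Or.inl hpos.ne')).div_const (p + 1)
  have e4 := (hh.const_mul (2 * m - 2)).mul hh1
  refine (e1.mul ((e2.add e3).add e4)).congr_deriv ?_
  have f1 : t ^ m = t ^ (m - 1) * t := by
    rw [← Real.rpow_add_one ht.ne']
    congr 1
    ring
  have f2 : h t ^ (p + 1) = h t ^ p * h t := Real.rpow_add_one hpos.ne' p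
  have hp1 : p + 1 ≠ 0 := by linarith
  simp only [id_eq, f1, f2, show p + 1 - 1 = p by ring, Pi.add_apply, Pi.mul_apply, Pi.pow_apply]
  rw [mul_right_comm (h1 t) (p + 1), mul_div_assoc (h1 t * _), div_self hp1]
  push_cast
  linear_combination t ^ (m - 1) * (t * h1 t + (m - 1) / 2 * h t) * heq

end Pohozaev

/-! ### Radial solutions below the exponent `(k + 2) / (k - 2)` -/

section RadialNonexistence

/-- The profile `h(|x|²)` of a positive radial solution is convex in `t = |x|²`, so that the
equation is the Lane–Emden equation in dimension `k`: where `h'' < 0` one would have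
`h' = -hᵖ / (2k)`, which is increasing because `h` is decreasing. -/
theorem second_deriv_nonneg {k p : ℝ} (hk : 0 < k) (hp : 0 < p) {h h1 h2 : ℝ → ℝ}
    (hpos : ∀ t, 0 < t → 0 < h t)
    (hh : ∀ t, 0 < t → HasDerivAt h (h1 t) t) (hh1 : ∀ t, 0 < t → HasDerivAt h1 (h2 t) t)
    (hc : ∀ t, 0 < t → ContinuousAt h2 t)
    (heq : ∀ t, 0 < t → 2 * k * h1 t + 4 * t * max (h2 t) 0 + h t ^ p = 0) {t : ℝ} (ht : 0 < t) :
    0 ≤ h2 t := by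
  by_contra hneg
  push Not at hneg
  have hev : h1 =ᶠ[𝓝 t] fun s => -(1 / (2 * k)) * h s ^ p := by
    filter_upwards [(hc t ht).eventually_lt_const hneg, Ioi_mem_nhds ht] with s hs1 hs2
    have := heq s hs2
    rw [max_eq_right hs1.le] at this
    field_simp
    linarith
  have hd := (((hh t ht).rpow_const (p := p) (Or.inl (hpos t ht).ne')).const_mul
    (-(1 / (2 * k)))).congr_of_eventuallyEq hev
  have huniq := (hh1 t ht).unique hd
  have h3 : 0 < h t ^ p := Real.rpow_pos_of_pos (hpos t ht) p
  have h4 : 0 < h t ^ (p - 1) := Real.rpow_pos_of_pos (hpos t ht) _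
  have h5 : h1 t < 0 := by
    rw [hev.self_of_nhds]
    have : 0 < 1 / (2 * k) * h t ^ p := by positivity
    linarith
  have h6 : 0 < 1 / (2 * k) * (-h1 t * p * h t ^ (p - 1)) := by
    have : 0 < -h1 t := by linarith
    positivity
  linarith

/-- There is no positive profile on `[0, ∞)` for subcritical `p`: the Pohozaev functional is
increasing and vanishes at `0`, whereas the decay `h ≤ C t^(-1/(p-1))` makes it vanish at
infinity. -/
theorem not_exists_profile {k p : ℝ} (hk : 2 < k) (hp1 : 1 < p) (hp : p < (k + 2) / (k - 2))
    {h h1 h2 : ℝ → ℝ} (hcont : ContinuousOn h (Set.Ici 0)) (hpos : ∀ t, 0 ≤ t → 0 < h t)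
    (hh : ∀ t, 0 < t → HasDerivAt h (h1 t) t) (hh1 : ∀ t, 0 < t → HasDerivAt h1 (h2 t) t)
    (hc : ∀ t, 0 < t → ContinuousAt h2 t)
    (heq : ∀ t, 0 < t → 2 * k * h1 t + 4 * t * max (h2 t) 0 + h t ^ p = 0) : False := by
  have hk0 : 0 < k := by linarith
  have hp0 : 0 < p := by linarith
  rw [lt_div_iff₀ (by linarith)] at hp
  have hh2 : ∀ t, 0 < t → 0 ≤ h2 t := fun t ht =>
    second_deriv_nonneg hk0 hp0 (fun t ht => hpos t ht.le) hh hh1 hc heq ht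
  have hh1le : ∀ t, 0 < t → 2 * k * h1 t ≤ -h t ^ p := fun t ht => by
    have h3 : 0 ≤ 4 * t * max (h2 t) 0 := by positivity
    linarith [heq t ht]
  have hh1neg : ∀ t, 0 < t → h1 t < 0 := fun t ht => by
    have h3 : 0 < h t ^ p := Real.rpow_pos_of_pos (hpos t ht.le) p
    have h4 := hh1le t ht
    by_contra hn
    push Not at hn
    have : 0 ≤ 2 * k * h1 t := by positivity
    linarith
  have hanti : AntitoneOn h (Set.Ici 0) := by
    refine antitoneOn_of_deriv_nonpos (convex_Ici 0) hcont ?_ ?_ <;> rw [interior_Ici]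
    · exact fun t ht => (hh t ht).differentiableAt.differentiableWithinAt
    · intro t ht
      rw [(hh t ht).deriv]
      exact (hh1neg t ht).le
  have hmono1 : MonotoneOn h1 (Set.Ioi 0) := by
    refine monotoneOn_of_deriv_nonneg (convex_Ioi 0)
      (fun t ht => (hh1 t ht).continuousAt.continuousWithinAt) ?_ ?_ <;> rw [interior_Ioi]
    · exact fun t ht => (hh1 t ht).differentiableAt.differentiableWithinAt
    · intro t ht
      rw [(hh1 t ht).deriv]
      exact hh2 t ht
  -- Convexity controls the derivative.
  have hderiv : ∀ t, 0 < t → -(t * h1 t) ≤ 2 * h (t / 2) := by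
    intro t ht
    obtain ⟨ξ, hξ, hξeq⟩ := exists_hasDerivAt_eq_slope h h1 (show t / 2 < t by linarith)
      (fun s hs => (hh s (by linarith [hs.1])).continuousAt.continuousWithinAt)
      (fun s hs => hh s (by linarith [hs.1]))
    have h3 : h1 ξ ≤ h1 t := hmono1 (show 0 < ξ by linarith [hξ.1]) ht hξ.2.le
    have h4 := hpos t ht.le
    rw [hξeq, div_le_iff₀ (by linarith)] at h3
    linarith
  set m : ℝ := k / 2 with hm
  have hmp : 0 < m / (p + 1) - (m - 1) / 2 := by
    rw [sub_pos, div_lt_div_iff₀ (by norm_num) (by linarith), hm]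
    linarith
  let P := pohozaev m p h h1
  have hP : ∀ t, 0 < t → HasDerivAt P
      (t ^ (m - 1) * h t ^ (p + 1) * (m / (p + 1) - (m - 1) / 2)) t := fun t ht => by
    refine hasDerivAt_pohozaev hp0 ht (hpos t ht.le) (hh t ht) (hh1 t ht) ?_
    have := heq t ht
    rw [max_eq_left (hh2 t ht)] at this
    rw [hm]
    linarith
  have hPmono : StrictMonoOn P (Set.Ioi 0) := by
    refine strictMonoOn_of_deriv_pos (convex_Ioi 0)
      (fun t ht => (hP t ht).continuousAt.continuousWithinAt) ?_
    rw [interior_Ioi]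
    intro t ht
    have ht' : 0 < t := ht
    have := hpos t ht'.le
    rw [(hP t ht).deriv]
    positivity
  -- The functional is nonnegative in the limit `t → 0`.
  have hPhalf : 0 ≤ P (1 / 2) := by
    have hlow : ∀ t, 0 < t → t ≤ 1 / 2 →
        -((2 * m - 2) * h 0 * (2 * h 0) * t ^ (m - 1)) ≤ P (1 / 2) := by
      intro t ht ht2
      refine le_trans ?_ (hPmono.monotoneOn (show t ∈ Set.Ioi 0 from ht)
        (show (1 / 2 : ℝ) ∈ Set.Ioi 0 by norm_num) ht2)
      have f1 : t ^ m = t ^ (m - 1) * t := by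
        rw [← Real.rpow_add_one ht.ne']
        congr 1
        ring
      have f2 : h t ≤ h 0 := hanti (Set.mem_Ici.2 le_rfl) (Set.mem_Ici.2 ht.le) ht.le
      have f3 : h (t / 2) ≤ h 0 :=
        hanti (Set.mem_Ici.2 le_rfl) (Set.mem_Ici.2 (by linarith)) (by linarith)
      have f4 := hderiv t ht
      have f5 := hpos t ht.le
      have f6 : 0 ≤ -(t * h1 t) := by
        have := mul_nonneg ht.le (neg_nonneg.2 (hh1neg t ht).le)
        linarith
      have f7 : h t * (-(t * h1 t)) ≤ h 0 * (2 * h 0) :=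
        mul_le_mul f2 (by linarith) f6 (by linarith)
      have f8 : 0 ≤ t ^ m * (2 * t * h1 t ^ 2 + h t ^ (p + 1) / (p + 1)) := by positivity
      have f9 : 0 ≤ (2 * m - 2) * t ^ (m - 1) := by
        have : 0 ≤ 2 * m - 2 := by rw [hm]; linarith
        positivity
      have f10 := mul_le_mul_of_nonneg_left f7 f9
      have f11 : P t = t ^ m * (2 * t * h1 t ^ 2 + h t ^ (p + 1) / (p + 1)) -
          (2 * m - 2) * t ^ (m - 1) * (h t * (-(t * h1 t))) := by
        simp only [P, pohozaev]
        rw [f1]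
        ring
      rw [f11]
      linarith
    have hlim : Filter.Tendsto (fun t : ℝ => -((2 * m - 2) * h 0 * (2 * h 0) * t ^ (m - 1)))
        (𝓝[>] 0) (𝓝 0) := by
      have hm1 : 0 < m - 1 := by rw [hm]; linarith
      have g1 : Filter.Tendsto (fun t : ℝ => t ^ (m - 1)) (𝓝[>] 0) (𝓝 0) := by
        have := (Real.continuousAt_rpow_const 0 (m - 1) (Or.inr hm1.le)).tendsto
        rw [Real.zero_rpow hm1.ne'] at this
        exact this.mono_left nhdsWithin_le_nhds
      simpa using (g1.const_mul ((2 * m - 2) * h 0 * (2 * h 0))).neg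
    refine le_of_tendsto hlim ?_
    filter_upwards [Ioc_mem_nhdsGT (show (0 : ℝ) < 1 / 2 by norm_num)] with t ht
    exact hlow t ht.1 ht.2
  have hP1 : 0 < P 1 := hPhalf.trans_lt
    (hPmono (show (1 / 2 : ℝ) ∈ Set.Ioi 0 by norm_num) (show (1 : ℝ) ∈ Set.Ioi 0 by norm_num)
      (by norm_num))
  -- Decay of `h`, from `(h ^ (1 - p))' ≥ (p - 1) / (2 k)`.
  set b : ℝ := 1 / (p - 1) with hb
  have hpb : b * (p - 1) = 1 := by
    rw [hb]
    field_simp [show p - 1 ≠ 0 by linarith]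
  have hb0 : 0 < b := by
    rw [hb]
    exact one_div_pos.2 (by linarith)
  set c : ℝ := (p - 1) / (2 * k) with hcdef
  have hc0 : 0 < c := div_pos (by linarith) (by linarith)
  have hgrow : ∀ t, 0 ≤ t → c * t ≤ h t ^ (1 - p) := by
    have hmono : MonotoneOn (fun t => h t ^ (1 - p) - c * t) (Set.Ici 0) := by
      have hd : ∀ t, 0 < t → HasDerivAt (fun t => h t ^ (1 - p) - c * t)
          (h1 t * (1 - p) * h t ^ (1 - p - 1) - c * 1) t := fun t ht =>
        ((hh t ht).rpow_const (Or.inl (hpos t ht.le).ne')).sub ((hasDerivAt_id t).const_mul c)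
      refine monotoneOn_of_deriv_nonneg (convex_Ici 0)
        ((hcont.rpow_const fun t ht => Or.inl (hpos t ht).ne').sub (by fun_prop)) ?_ ?_ <;>
        rw [interior_Ici]
      · exact fun t ht => (hd t ht).differentiableAt.differentiableWithinAt
      · intro t ht
        have ht' : 0 < t := ht
        have e0 := hpos t ht'.le
        have e1 := hh1le t ht
        have e2 : 0 < h t ^ p := Real.rpow_pos_of_pos e0 p
        rw [(hd t ht).deriv, show 1 - p - 1 = -p by ring, Real.rpow_neg e0.le, hcdef, mul_one,
          sub_nonneg, ← div_eq_mul_inv, div_le_div_iff₀ (by linarith) e2]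
        nlinarith
    intro t ht
    have e1 := hmono (Set.mem_Ici.2 le_rfl) (Set.mem_Ici.2 ht) ht
    have e2 : 0 < h 0 ^ (1 - p) := Real.rpow_pos_of_pos (hpos 0 le_rfl) _
    simp only [mul_zero, sub_zero] at e1
    linarith
  have hdecay : ∀ t, 0 < t → h t ≤ (c * t) ^ (-b) := by
    intro t ht
    have e0 := hpos t ht.le
    have e1 : (h t ^ (1 - p)) ^ (-b) ≤ (c * t) ^ (-b) :=
      Real.rpow_le_rpow_of_nonpos (by positivity) (hgrow t ht.le) (by linarith)
    rwa [← Real.rpow_mul e0.le, show (1 - p) * -b = 1 by linear_combination hpb,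
      Real.rpow_one] at e1
  -- The functional tends to `0` at infinity.
  have hup : ∀ t, 0 < t → P t ≤
      (8 * (c / 2) ^ (-(2 * b)) + c ^ (-(2 * b + 1)) / (p + 1)) * t ^ (-(2 * b + 1 - m)) := by
    intro t ht
    have e0 := hpos t ht.le
    have e1 : h t ^ (p + 1) ≤ c ^ (-(2 * b + 1)) * t ^ (-(2 * b + 1)) := by
      calc h t ^ (p + 1) ≤ ((c * t) ^ (-b)) ^ (p + 1) :=
            Real.rpow_le_rpow e0.le (hdecay t ht) (by linarith)
        _ = _ := by
            rw [← Real.rpow_mul (by positivity), Real.mul_rpow hc0.le ht.le,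
              show -b * (p + 1) = -(2 * b + 1) by linear_combination -hpb]
    have e2 : (t * h1 t) ^ 2 ≤ 4 * ((c / 2) ^ (-(2 * b)) * t ^ (-(2 * b))) := by
      have g1 := hderiv t ht
      have g2 := hdecay (t / 2) (by linarith)
      have g3 : 0 ≤ -(t * h1 t) := by
        have := mul_nonneg ht.le (neg_nonneg.2 (hh1neg t ht).le)
        linarith
      have g4 : -(t * h1 t) ≤ 2 * (c / 2 * t) ^ (-b) := by
        rw [show c / 2 * t = c * (t / 2) by ring]
        linarith
      have g5 := pow_le_pow_left₀ g3 g4 2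
      have g6 : ((c / 2 * t) ^ (-b)) ^ 2 = (c / 2) ^ (-(2 * b)) * t ^ (-(2 * b)) := by
        rw [← Real.rpow_natCast, ← Real.rpow_mul (by positivity),
          ← Real.mul_rpow (by positivity) ht.le]
        congr 1
        push_cast
        ring
      rw [neg_sq, mul_pow (2 : ℝ), g6] at g5
      linarith
    have e3 : t ^ m * t ^ (-(2 * b + 1)) = t ^ (-(2 * b + 1 - m)) := by
      rw [← Real.rpow_add ht]
      congr 1
      ring
    have e4 : t ^ (-(2 * b)) = t * t ^ (-(2 * b + 1)) := by
      rw [mul_comm t, ← Real.rpow_add_one ht.ne']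
      congr 1
      ring
    rw [e4] at e2
    have e5 : t * h1 t ^ 2 ≤ 4 * ((c / 2) ^ (-(2 * b)) * t ^ (-(2 * b + 1))) := by
      refine le_of_mul_le_mul_left ?_ ht
      linarith
    have e6 : (2 * m - 2) * h t * h1 t ≤ 0 := by
      have : 0 ≤ (2 * m - 2) * h t := mul_nonneg (by rw [hm]; linarith) e0.le
      exact mul_nonpos_of_nonneg_of_nonpos this (hh1neg t ht).le
    have e7 : h t ^ (p + 1) / (p + 1) ≤ c ^ (-(2 * b + 1)) * t ^ (-(2 * b + 1)) / (p + 1) :=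
      div_le_div_of_nonneg_right e1 (by linarith)
    calc P t ≤ t ^ m * ((8 * (c / 2) ^ (-(2 * b)) + c ^ (-(2 * b + 1)) / (p + 1)) *
            t ^ (-(2 * b + 1))) := by
          refine mul_le_mul_of_nonneg_left ?_ (by positivity)
          have : (8 * (c / 2) ^ (-(2 * b)) + c ^ (-(2 * b + 1)) / (p + 1)) * t ^ (-(2 * b + 1)) =
            2 * (4 * ((c / 2) ^ (-(2 * b)) * t ^ (-(2 * b + 1)))) +
              c ^ (-(2 * b + 1)) * t ^ (-(2 * b + 1)) / (p + 1) := by ring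
          rw [this]
          linarith
      _ = _ := by rw [← e3]; ring
  have hexp : 0 < 2 * b + 1 - m := by
    have : 0 < (2 * b + 1 - m) * (p - 1) := by
      have : (2 * b + 1 - m) * (p - 1) = 2 + (1 - m) * (p - 1) := by linear_combination 2 * hpb
      rw [this, hm]
      linarith
    exact pos_of_mul_pos_left this (by linarith)
  have hlim := (tendsto_rpow_neg_atTop hexp).const_mul
    (8 * (c / 2) ^ (-(2 * b)) + c ^ (-(2 * b + 1)) / (p + 1))
  rw [mul_zero] at hlim
  obtain ⟨t, ht1, ht2⟩ := ((hlim.eventually_lt_const hP1).and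
    (Filter.eventually_ge_atTop (1 : ℝ))).exists
  have ht0 : 0 < t := by linarith
  have := hPmono.monotoneOn (show (1 : ℝ) ∈ Set.Ioi 0 by norm_num)
    (show t ∈ Set.Ioi 0 from ht0) ht2
  linarith [hup t ht0]

variable {N k : ℕ} {p : ℝ}

theorem not_isClassicalSolution_of_isRadial (hk : 2 < k) (hkN : k < N) (hp1 : 1 < p)
    (hp : p < ((k : ℝ) + 2) / (k - 2)) {u : EuclideanSpace ℝ (Fin N) → ℝ} (hrad : IsRadial u)
    (hpos : ∀ x, 0 < u x) : ¬ IsClassicalSolution k p u := by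
  rintro ⟨hu, hsol⟩
  have hk2 : (2 : ℝ) < k := by exact_mod_cast hk
  obtain ⟨g, hg⟩ := hrad
  let e : EuclideanSpace ℝ (Fin N) := EuclideanSpace.single ⟨0, by omega⟩ 1
  have he : ‖e‖ = 1 := by simp [e]
  let h : ℝ → ℝ := fun t => u (√t • e)
  have hnorm : ∀ t, 0 ≤ t → ‖√t • e‖ ^ 2 = t := fun t ht => by
    rw [norm_smul, he, mul_one, Real.norm_of_nonneg (Real.sqrt_nonneg t), Real.sq_sqrt ht]
  have huh : ∀ x, u x = h (‖x - 0‖ ^ 2) := fun x => by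
    simp only [h, sub_zero, Real.sqrt_sq (norm_nonneg x)]
    rw [hg x, hg, norm_smul, he, mul_one, norm_norm]
  have hhC : ContDiffOn ℝ 2 h (Set.Ioi 0) := fun t ht => by
    have ht0 : t ≠ 0 := ne_of_gt ht
    exact (hu.contDiffAt.comp t ((Real.contDiffAt_sqrt ht0).smul contDiffAt_const)).contDiffWithinAt
  have hh1C : ContDiffOn ℝ 1 (deriv h) (Set.Ioi 0) :=
    hhC.deriv_of_isOpen isOpen_Ioi (by norm_num)
  have hh2C : ContDiffOn ℝ 0 (deriv (deriv h)) (Set.Ioi 0) :=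
    hh1C.deriv_of_isOpen isOpen_Ioi (by norm_num)
  have hh : ∀ t, 0 < t → HasDerivAt h (deriv h t) t := fun t ht =>
    ((hhC.differentiableOn (by norm_num)).differentiableAt (Ioi_mem_nhds ht)).hasDerivAt
  have hh1 : ∀ t, 0 < t → HasDerivAt (deriv h) (deriv (deriv h) t) t := fun t ht =>
    ((hh1C.differentiableOn (by norm_num)).differentiableAt (Ioi_mem_nhds ht)).hasDerivAt
  refine not_exists_profile hk2 hp1 hp (h := h) ?_ (fun t _ => hpos _) hh hh1
    (fun t ht => hh2C.continuousOn.continuousAt (Ioi_mem_nhds ht)) fun t ht => ?_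
  · exact (hu.continuous.comp (by fun_prop)).continuousOn
  · have hx : ‖√t • e - 0‖ ^ 2 = t := by rw [sub_zero, hnorm t ht.le]
    have := hsol (√t • e)
    rw [Pplus_hessian_comp_normSq_sub (by omega) hkN (h := h) (h1 := deriv h)
      (h2 := deriv (deriv h) t) 0 _ _ (Filter.Eventually.of_forall huh)
      (by rw [hx]; exact Filter.eventually_of_mem (Ioi_mem_nhds ht) fun s hs => hh s hs)
      (by rw [hx]; exact hh1 t ht), hx] at this
    exact this

end RadialNonexistence

/-! ### A globally Lipschitz modification of the power nonlinearity -/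

section TruncPow

/-- The derivative `p y^(p-1)` of the power function, frozen outside `[0, 1]`. -/
def truncPowDeriv (p y : ℝ) : ℝ := p * min 1 (max 0 y) ^ (p - 1)

/-- The `C¹` and globally Lipschitz function which is `y ^ p` on `[0, 1]`, vanishes for `y ≤ 0` and
is affine for `y ≥ 1`. -/
def truncPow (p y : ℝ) : ℝ := ∫ s in (0 : ℝ)..y, truncPowDeriv p s

variable {p : ℝ}

theorem continuous_truncPowDeriv (hp : 1 < p) : Continuous (truncPowDeriv p) :=
  continuous_const.mul ((continuous_const.min (continuous_const.max continuous_id)).rpow_const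
    fun _ => Or.inr (by linarith))

theorem truncPowDeriv_nonneg (hp : 1 < p) (y : ℝ) : 0 ≤ truncPowDeriv p y := by
  unfold truncPowDeriv
  positivity

theorem truncPowDeriv_le (hp : 1 < p) (y : ℝ) : truncPowDeriv p y ≤ p :=
  mul_le_of_le_one_right (by linarith)
    (Real.rpow_le_one (le_min zero_le_one (le_max_left _ _)) (min_le_left _ _) (by linarith))

theorem hasDerivAt_truncPow (hp : 1 < p) (y : ℝ) :
    HasDerivAt (truncPow p) (truncPowDeriv p y) y :=
  (continuous_truncPowDeriv hp).integral_hasStrictDerivAt 0 y |>.hasDerivAt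

theorem monotone_truncPow (hp : 1 < p) : Monotone (truncPow p) :=
  monotone_of_deriv_nonneg (fun y => (hasDerivAt_truncPow hp y).differentiableAt) fun y => by
    rw [(hasDerivAt_truncPow hp y).deriv]
    exact truncPowDeriv_nonneg hp y

theorem truncPow_zero : truncPow p 0 = 0 := intervalIntegral.integral_same

theorem truncPow_nonneg (hp : 1 < p) (y : ℝ) : 0 ≤ truncPow p y := by
  rcases le_total 0 y with hy | hy
  · simpa [truncPow_zero] using monotone_truncPow hp hy
  · refine le_of_eq (Eq.symm ?_)
    refine intervalIntegral.integral_zero_ae (Filter.Eventually.of_forall fun s hs => ?_)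
    rw [Set.uIoc_of_ge hy] at hs
    rw [truncPowDeriv, max_eq_left hs.2, min_eq_right zero_le_one,
      Real.zero_rpow (by linarith), mul_zero]

theorem truncPow_eq_rpow (hp : 1 < p) {y : ℝ} (hy0 : 0 ≤ y) (hy1 : y ≤ 1) :
    truncPow p y = y ^ p := by
  have h1 : truncPow p y = ∫ s in (0 : ℝ)..y, p * s ^ (p - 1) := by
    refine intervalIntegral.integral_congr fun s hs => ?_
    rw [Set.uIcc_of_le hy0] at hs
    simp only [truncPowDeriv]
    rw [max_eq_right hs.1, min_eq_right (hs.2.trans hy1)]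
  rw [h1, intervalIntegral.integral_const_mul, integral_rpow (Or.inl (by linarith)),
    sub_add_cancel, Real.zero_rpow (by linarith)]
  field_simp
  ring

theorem abs_truncPow_sub_le (hp : 1 < p) (y z : ℝ) :
    |truncPow p y - truncPow p z| ≤ p * |y - z| := by
  have h := Convex.norm_image_sub_le_of_norm_hasDerivWithin_le (s := Set.univ) (C := p)
    (fun x _ => (hasDerivAt_truncPow hp x).hasDerivWithinAt)
    (fun x _ => by
      rw [Real.norm_of_nonneg (truncPowDeriv_nonneg hp x)]
      exact truncPowDeriv_le hp x) convex_univ (Set.mem_univ z) (Set.mem_univ y)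
  simpa only [Real.norm_eq_abs] using h

end TruncPow

/-! ### Global existence for the singular initial value problem -/

section Picard

/-- The weighted mean `∫₀¹ τᵏ⁻¹ φ(s τ²) dτ`. -/
def radialMean (k : ℕ) (φ : ℝ → ℝ) (s : ℝ) : ℝ := ∫ τ in (0 : ℝ)..1, τ ^ (k - 1) * φ (s * τ ^ 2)

/-- The Picard operator `h ↦ 1 - (1/2) ∫₀ᵗ radialMean k (f ∘ h)`, in the variable `t = r²`, of
`u'' + (k - 1) u' / r + f(u) = 0`, `u(0) = 1`. The integral is rescaled to `[0, 1]`. -/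
def picard (k : ℕ) (f h : ℝ → ℝ) (t : ℝ) : ℝ :=
  1 - t / 2 * ∫ θ in (0 : ℝ)..1, radialMean k (fun x => f (h x)) (t * θ)

variable {k : ℕ}

theorem continuous_radialMean {φ : ℝ → ℝ} (hφ : Continuous φ) : Continuous (radialMean k φ) := by
  unfold radialMean
  apply intervalIntegral.continuous_parametric_intervalIntegral_of_continuous' (by fun_prop)

theorem continuous_picard {f h : ℝ → ℝ} (hf : Continuous f) (hh : Continuous h) :
    Continuous (picard k f h) := by
  have h1 : Continuous (radialMean k fun x => f (h x)) := continuous_radialMean (hf.comp hh)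
  unfold picard
  refine continuous_const.sub ((continuous_id.div_const 2).mul ?_)
  exact intervalIntegral.continuous_parametric_intervalIntegral_of_continuous' (by fun_prop) 0 1

theorem abs_radialMean_sub_le {φ ψ : ℝ → ℝ} (hφ : Continuous φ) (hψ : Continuous ψ) {s B : ℝ}
    (hB : ∀ τ ∈ Set.Icc (0 : ℝ) 1, |φ (s * τ ^ 2) - ψ (s * τ ^ 2)| ≤ B) :
    |radialMean k φ s - radialMean k ψ s| ≤ B := by
  unfold radialMean
  rw [← intervalIntegral.integral_sub (Continuous.intervalIntegrable (by fun_prop) _ _)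
    (Continuous.intervalIntegrable (by fun_prop) _ _)]
  have h := intervalIntegral.norm_integral_le_of_norm_le_const (a := (0 : ℝ)) (b := 1) (C := B)
    (f := fun τ : ℝ => τ ^ (k - 1) * φ (s * τ ^ 2) - τ ^ (k - 1) * ψ (s * τ ^ 2)) ?_
  · simpa using h
  · intro τ hτ
    rw [Set.uIoc_of_le zero_le_one] at hτ
    have h1 := hB τ ⟨hτ.1.le, hτ.2⟩
    have h2 : τ ^ (k - 1) ≤ 1 := pow_le_one₀ hτ.1.le hτ.2
    have h3 : 0 ≤ τ ^ (k - 1) := pow_nonneg hτ.1.le _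
    rw [← mul_sub, Real.norm_eq_abs, abs_mul, abs_of_nonneg h3]
    have h4 := abs_nonneg (φ (s * τ ^ 2) - ψ (s * τ ^ 2))
    nlinarith

/-- For a nonlinearity with Lipschitz constant `p`, the Picard operator is a contraction with
constant `1/2` in the norm with weight `exp (-p |t|)`. -/
theorem abs_picard_sub_le {f : ℝ → ℝ} {p : ℝ} (hp : 0 < p)
    (hf : ∀ y z, |f y - f z| ≤ p * |y - z|) (hfc : Continuous f) {g h : ℝ → ℝ} (hg : Continuous g)
    (hh : Continuous h) {D : ℝ} (hD : ∀ t, |g t - h t| ≤ D * Real.exp (p * |t|)) (t : ℝ) :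
    |picard k f g t - picard k f h t| ≤ D / 2 * Real.exp (p * |t|) := by
  have hD0 : 0 ≤ D := by
    have := (abs_nonneg _).trans (hD 0)
    simpa using this
  have hG : Continuous (radialMean k fun x => f (g x)) := continuous_radialMean (hfc.comp hg)
  have hH : Continuous (radialMean k fun x => f (h x)) := continuous_radialMean (hfc.comp hh)
  have hmean : ∀ θ ∈ Set.Icc (0 : ℝ) 1,
      |radialMean k (fun x => f (g x)) (t * θ) - radialMean k (fun x => f (h x)) (t * θ)| ≤
        p * D * Real.exp (p * |t| * θ) := by
    intro θ hθ
    refine abs_radialMean_sub_le (hfc.comp hg) (hfc.comp hh) fun τ hτ => ?_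
    refine (hf _ _).trans ?_
    rw [mul_assoc p D]
    refine mul_le_mul_of_nonneg_left ((hD _).trans ?_) hp.le
    refine mul_le_mul_of_nonneg_left (Real.exp_le_exp.2 ?_) hD0
    rw [abs_mul, abs_mul, abs_of_nonneg hθ.1, abs_of_nonneg (sq_nonneg τ), mul_assoc p]
    refine mul_le_mul_of_nonneg_left ?_ hp.le
    exact mul_le_of_le_one_right (mul_nonneg (abs_nonneg t) hθ.1) (pow_le_one₀ hτ.1 hτ.2)
  have hint : |∫ θ in (0 : ℝ)..1, (radialMean k (fun x => f (g x)) (t * θ) -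
      radialMean k (fun x => f (h x)) (t * θ))| ≤
        ∫ θ in (0 : ℝ)..1, p * D * Real.exp (p * |t| * θ) := by
    exact intervalIntegral.norm_integral_le_of_norm_le (μ := MeasureTheory.volume)
      (f := fun θ => radialMean k (fun x => f (g x)) (t * θ) -
        radialMean k (fun x => f (h x)) (t * θ))
      (g := fun θ => p * D * Real.exp (p * |t| * θ)) zero_le_one
      (Filter.Eventually.of_forall fun θ hθ => hmean θ (Set.Ioc_subset_Icc_self hθ))
      (Continuous.intervalIntegrable (by fun_prop) _ _)
  have hexp : |t| * ∫ θ in (0 : ℝ)..1, p * D * Real.exp (p * |t| * θ) =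
      D * (Real.exp (p * |t|) - 1) := by
    have hd : ∀ θ ∈ Set.uIcc (0 : ℝ) 1, HasDerivAt (fun θ => D * Real.exp (p * |t| * θ))
        (|t| * (p * D * Real.exp (p * |t| * θ))) θ := fun θ _ => by
      refine ((((hasDerivAt_id θ).const_mul (p * |t|)).exp).const_mul D).congr_deriv ?_
      simp only [id_eq]
      ring
    rw [← intervalIntegral.integral_const_mul, intervalIntegral.integral_eq_sub_of_hasDerivAt hd
      (Continuous.intervalIntegrable (by fun_prop) _ _)]
    simp
    ring
  have hdiff : picard k f g t - picard k f h t =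
      -(t / 2) * ∫ θ in (0 : ℝ)..1, (radialMean k (fun x => f (g x)) (t * θ) -
        radialMean k (fun x => f (h x)) (t * θ)) := by
    rw [intervalIntegral.integral_sub (Continuous.intervalIntegrable (by fun_prop) _ _)
      (Continuous.intervalIntegrable (by fun_prop) _ _)]
    unfold picard
    ring
  rw [hdiff, abs_mul, abs_neg, abs_div, abs_two]
  calc _ ≤ |t| / 2 * ∫ θ in (0 : ℝ)..1, p * D * Real.exp (p * |t| * θ) :=
        mul_le_mul_of_nonneg_left hint (by positivity)
    _ = D * (Real.exp (p * |t|) - 1) / 2 := by rw [← hexp]; ring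
    _ ≤ _ := by linarith

theorem exists_picard_eq {f : ℝ → ℝ} {p : ℝ} (hp : 0 < p)
    (hf : ∀ y z, |f y - f z| ≤ p * |y - z|) (hfc : Continuous f) (hf0 : f 0 = 0) :
    ∃ h : ℝ → ℝ, Continuous h ∧ ∀ t, h t = picard k f h t := by
  let w : ℝ → ℝ := fun t => Real.exp (p * |t|)
  have hwc : Continuous w := by fun_prop
  have hw0 : ∀ t, 0 < w t := fun t => Real.exp_pos _
  have hw1 : ∀ t, 1 ≤ w t := fun t => Real.one_le_exp (by positivity)
  have hpc : ∀ g : BoundedContinuousFunction ℝ ℝ, Continuous (picard k f fun s => w s * g s) :=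
    fun g =>
    continuous_picard hfc (by fun_prop)
  have hcontr : ∀ (g h : BoundedContinuousFunction ℝ ℝ) (t : ℝ),
      |(w t)⁻¹ * picard k f (fun s => w s * g s) t -
        (w t)⁻¹ * picard k f (fun s => w s * h s) t| ≤ dist g h / 2 := by
    intro g h t
    have h1 := abs_picard_sub_le (k := k) hp hf hfc (g := fun s => w s * g s)
      (h := fun s => w s * h s) (by fun_prop) (by fun_prop) (D := dist g h) (fun s => by
        rw [← mul_sub, abs_mul, abs_of_pos (hw0 s), mul_comm]
        exact mul_le_mul_of_nonneg_right (g.dist_coe_le_dist s) (hw0 s).le) t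
    rw [← mul_sub, abs_mul, abs_of_pos (inv_pos.2 (hw0 t)), inv_mul_le_iff₀ (hw0 t)]
    linarith
  have hzero : ∀ t, picard k f (fun s => w s * (0 : BoundedContinuousFunction ℝ ℝ) s) t = 1 := by
    intro t
    simp [picard, radialMean, hf0]
  let S : BoundedContinuousFunction ℝ ℝ → BoundedContinuousFunction ℝ ℝ := fun g =>
    BoundedContinuousFunction.ofNormedAddCommGroup
      (fun t => (w t)⁻¹ * picard k f (fun s => w s * g s) t)
      ((hwc.inv₀ fun t => (hw0 t).ne').mul (hpc g)) (dist g 0 / 2 + 1) (fun t => by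
        have h1 := hcontr g 0 t
        rw [hzero, mul_one] at h1
        have h2 : (w t)⁻¹ ≤ 1 := inv_le_one_of_one_le₀ (hw1 t)
        have h3 : 0 < (w t)⁻¹ := inv_pos.2 (hw0 t)
        rw [Real.norm_eq_abs]
        rw [abs_le] at h1 ⊢
        constructor <;> linarith)
  have hS : ContractingWith (1 / 2) S := by
    refine ⟨by norm_num, LipschitzWith.of_dist_le_mul fun g h => ?_⟩
    rw [BoundedContinuousFunction.dist_le (by positivity)]
    intro t
    refine (hcontr g h t).trans (le_of_eq ?_)
    push_cast
    ring
  let g := hS.fixedPoint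
  have hg : S g = g := hS.fixedPoint_isFixedPt
  refine ⟨fun t => w t * g t, by fun_prop, fun t => ?_⟩
  have h1 : (w t)⁻¹ * picard k f (fun s => w s * g s) t = g t := congrFun (congrArg (⇑) hg) t
  change w t * g t = picard k f (fun s => w s * g s) t
  rw [← h1, mul_inv_cancel_left₀ (hw0 t).ne']

/-- A `C¹` function `φ` has a `C¹` mean `∫₀¹ τᵏ⁻¹ φ(s τ²) dτ`. -/
theorem hasDerivAt_radialMean (hk : 0 < k) {φ φ' : ℝ → ℝ} (hφ : ∀ s, HasDerivAt φ (φ' s) s)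
    (hφ' : Continuous φ') (s : ℝ) :
    HasDerivAt (radialMean k φ) (radialMean (k + 2) φ' s) s := by
  have hφc : Continuous φ := continuous_iff_continuousAt.2 fun s => (hφ s).continuousAt
  have hK : IsCompact (Metric.closedBall s 1 ×ˢ Set.Icc (0 : ℝ) 1) :=
    (isCompact_closedBall s 1).prod isCompact_Icc
  obtain ⟨C, hC⟩ := hK.exists_bound_of_continuousOn
    (f := fun q : ℝ × ℝ => q.2 ^ (k + 2 - 1) * φ' (q.1 * q.2 ^ 2)) (by fun_prop)
  refine (intervalIntegral.hasDerivAt_integral_of_dominated_loc_of_deriv_le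
    (F := fun s τ => τ ^ (k - 1) * φ (s * τ ^ 2))
    (F' := fun s τ => τ ^ (k + 2 - 1) * φ' (s * τ ^ 2)) (bound := fun _ => C)
    (Metric.closedBall_mem_nhds s one_pos) ?_ ?_ ?_ ?_ ?_ ?_).2
  · exact Filter.Eventually.of_forall fun x =>
      Continuous.aestronglyMeasurable (by fun_prop)
  · exact Continuous.intervalIntegrable (by fun_prop) _ _
  · exact Continuous.aestronglyMeasurable (by fun_prop)
  · refine Filter.Eventually.of_forall fun τ hτ x hx => hC (x, τ) ⟨hx, ?_⟩
    rw [Set.uIoc_of_le zero_le_one] at hτ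
    exact Set.Ioc_subset_Icc_self hτ
  · exact Continuous.intervalIntegrable (by fun_prop) _ _
  · refine Filter.Eventually.of_forall fun τ _ x _ => ?_
    have h1 : HasDerivAt (fun x : ℝ => x * τ ^ 2) (τ ^ 2) x := by
      simpa using (hasDerivAt_id x).mul_const (τ ^ 2)
    refine (((hφ (x * τ ^ 2)).comp x h1).const_mul (τ ^ (k - 1))).congr_deriv ?_
    rw [show k + 2 - 1 = (k - 1) + 2 by omega, pow_add]
    ring

/-- Integration by parts in the radial mean. -/
theorem two_mul_radialMean_deriv (hk : 0 < k) {φ φ' : ℝ → ℝ} (hφ : ∀ s, HasDerivAt φ (φ' s) s)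
    (hφ' : Continuous φ') (s : ℝ) :
    2 * s * radialMean (k + 2) φ' s + k * radialMean k φ s = φ s := by
  have hφc : Continuous φ := continuous_iff_continuousAt.2 fun s => (hφ s).continuousAt
  have hd : ∀ τ ∈ Set.uIcc (0 : ℝ) 1, HasDerivAt (fun τ : ℝ => τ ^ k * φ (s * τ ^ 2))
      (2 * s * (τ ^ (k + 2 - 1) * φ' (s * τ ^ 2)) + k * (τ ^ (k - 1) * φ (s * τ ^ 2))) τ := by
    intro τ _
    have h1 : HasDerivAt (fun τ : ℝ => s * τ ^ 2) (s * (2 * τ)) τ := by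
      simpa using (hasDerivAt_pow 2 τ).const_mul s
    refine ((hasDerivAt_pow k τ).mul ((hφ (s * τ ^ 2)).comp τ h1)).congr_deriv ?_
    rw [show k + 2 - 1 = k + 1 by omega, pow_succ]
    simp only [Function.comp_apply]
    ring_nf
  have h := intervalIntegral.integral_eq_sub_of_hasDerivAt hd
    (Continuous.intervalIntegrable (by fun_prop) _ _)
  rw [intervalIntegral.integral_add (Continuous.intervalIntegrable (by fun_prop) _ _)
    (Continuous.intervalIntegrable (by fun_prop) _ _), intervalIntegral.integral_const_mul,
    intervalIntegral.integral_const_mul] at h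
  simpa [radialMean, hk.ne'] using h

theorem picard_eq_sub_integral (f h : ℝ → ℝ) (t : ℝ) :
    picard k f h t = 1 - 1 / 2 * ∫ s in (0 : ℝ)..t, radialMean k (fun x => f (h x)) s := by
  have := intervalIntegral.smul_integral_comp_mul_left (a := 0) (b := 1)
    (radialMean k fun x => f (h x)) t
  rw [mul_zero, mul_one, smul_eq_mul] at this
  rw [picard, ← this]
  ring

end Picard

/-! ### Positive solutions from the exponent `(k + 2) / (k - 2)` on -/

section Solution

variable {k : ℕ} {p : ℝ}

/-- The solution, on all of `ℝ`, of the Lane–Emden equation with the modified nonlinearity. It is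
convex because its derivative is minus a mean of a decreasing function. -/
theorem exists_truncated_profile (hk : 0 < k) (hp : 1 < p) :
    ∃ h : ℝ → ℝ, h 0 = 1 ∧
      (∀ t, HasDerivAt h (-(1 / 2) * radialMean k (fun s => truncPow p (h s)) t) t) ∧
      ∃ h2 : ℝ → ℝ, Continuous h2 ∧
        (∀ t, HasDerivAt (fun t => -(1 / 2) * radialMean k (fun s => truncPow p (h s)) t)
          (h2 t) t) ∧
        (∀ t, 0 ≤ h2 t) ∧
        ∀ t, 4 * t * h2 t + 2 * k * (-(1 / 2) * radialMean k (fun s => truncPow p (h s)) t) +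
          truncPow p (h t) = 0 := by
  have hfc : Continuous (truncPow p) :=
    continuous_iff_continuousAt.2 fun y => (hasDerivAt_truncPow hp y).continuousAt
  obtain ⟨h, hc, hfix⟩ := exists_picard_eq (k := k) (by linarith) (abs_truncPow_sub_le hp) hfc
    truncPow_zero
  set h1 : ℝ → ℝ := fun t => -(1 / 2) * radialMean k (fun s => truncPow p (h s)) t with hh1
  have hmc : Continuous (radialMean k fun s => truncPow p (h s)) :=
    continuous_radialMean (hfc.comp hc)
  have hh : ∀ t, HasDerivAt h (h1 t) t := by
    intro t
    have e : h = fun t =>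
        1 - 1 / 2 * ∫ s in (0 : ℝ)..t, radialMean k (fun x => truncPow p (h x)) s :=
      funext fun t => (hfix t).trans (picard_eq_sub_integral _ _ t)
    have h3 := ((hmc.integral_hasStrictDerivAt 0 t).hasDerivAt.const_mul (1 / 2)).const_sub 1
    refine (h3.congr_of_eventuallyEq (Filter.EventuallyEq.of_eq e)).congr_deriv ?_
    simp only [hh1]
    ring
  have hφ : ∀ s, HasDerivAt (fun s => truncPow p (h s)) (truncPowDeriv p (h s) * h1 s) s :=
    fun s => (hasDerivAt_truncPow hp (h s)).comp s (hh s)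
  have hh1c : Continuous h1 := continuous_const.mul hmc
  have hφ' : Continuous fun s => truncPowDeriv p (h s) * h1 s :=
    ((continuous_truncPowDeriv hp).comp hc).mul hh1c
  have hmean_nonneg : ∀ t, 0 ≤ radialMean k (fun s => truncPow p (h s)) t := fun t =>
    intervalIntegral.integral_nonneg zero_le_one fun τ hτ =>
      mul_nonneg (pow_nonneg hτ.1 _) (truncPow_nonneg hp _)
  refine ⟨h, by rw [hfix 0]; simp [picard], hh,
    fun t => -(1 / 2) * radialMean (k + 2) (fun s => truncPowDeriv p (h s) * h1 s) t,
    continuous_const.mul (continuous_radialMean hφ'),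
    fun t => (hasDerivAt_radialMean hk hφ hφ' t).const_mul _, fun t => ?_, fun t => ?_⟩
  · have : radialMean (k + 2) (fun s => truncPowDeriv p (h s) * h1 s) t ≤ 0 := by
      rw [← neg_nonneg, radialMean, ← intervalIntegral.integral_neg]
      refine intervalIntegral.integral_nonneg zero_le_one fun τ hτ => ?_
      have e1 := truncPowDeriv_nonneg hp (h (t * τ ^ 2))
      have e2 := hmean_nonneg (t * τ ^ 2)
      have e3 : 0 ≤ τ ^ (k + 2 - 1) := pow_nonneg hτ.1 _
      have e4 : 0 ≤ τ ^ (k + 2 - 1) * (truncPowDeriv p (h (t * τ ^ 2)) *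
          (1 / 2 * radialMean k (fun s => truncPow p (h s)) (t * τ ^ 2))) := by positivity
      simp only [hh1]
      linarith
    linarith
  · have := two_mul_radialMean_deriv hk hφ hφ' t
    simp only [hh1] at this ⊢
    linarith

/-- For `p` at least critical, the Pohozaev functional starts from `0` and is nonincreasing as long
as the profile is positive, whereas it would be positive at a first zero of the profile. -/
theorem exists_pos_profile (hk : 2 < k) (hp : ((k : ℝ) + 2) / (k - 2) ≤ p) :
    ∃ h h1 h2 : ℝ → ℝ, Continuous h2 ∧ (∀ t, HasDerivAt h (h1 t) t) ∧
      (∀ t, HasDerivAt h1 (h2 t) t) ∧ (∀ t, 0 ≤ h2 t) ∧ (∀ t, 0 ≤ t → 0 < h t) ∧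
      ∀ t, 0 ≤ t → 4 * t * h2 t + 2 * k * h1 t + h t ^ p = 0 := by
  have hk2 : (2 : ℝ) < k := by exact_mod_cast hk
  rw [div_le_iff₀ (by linarith)] at hp
  have hp1 : 1 < p := by nlinarith
  obtain ⟨h, hh0, hh, h2, hh2c, hh1, hh2, heq⟩ := exists_truncated_profile (k := k) (by omega) hp1
  set h1 : ℝ → ℝ := fun t => -(1 / 2) * radialMean k (fun s => truncPow p (h s)) t with h1def
  have hc : Continuous h := continuous_iff_continuousAt.2 fun t => (hh t).continuousAt
  have hh1c : Continuous h1 := continuous_iff_continuousAt.2 fun t => (hh1 t).continuousAt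
  have hfc : Continuous (truncPow p) :=
    continuous_iff_continuousAt.2 fun y => (hasDerivAt_truncPow hp1 y).continuousAt
  have hh1nonpos : ∀ t, h1 t ≤ 0 := fun t => by
    have : 0 ≤ radialMean k (fun s => truncPow p (h s)) t :=
      intervalIntegral.integral_nonneg zero_le_one fun τ hτ =>
        mul_nonneg (pow_nonneg hτ.1 _) (truncPow_nonneg hp1 _)
    simp only [h1def]
    linarith
  have hanti : Antitone h :=
    antitone_of_deriv_nonpos (fun t => (hh t).differentiableAt) fun t => by
      rw [(hh t).deriv]
      exact hh1nonpos t
  have hle1 : ∀ t, 0 ≤ t → h t ≤ 1 := fun t ht => hh0 ▸ hanti ht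
  have hpos : ∀ t, 0 ≤ t → 0 < h t := by
    by_contra hcon
    push Not at hcon
    obtain ⟨t₁, ht₁, hneg⟩ := hcon
    -- `T` is the first zero of `h`.
    obtain ⟨T, hT⟩ : ∃ T, IsLeast {t | 0 ≤ t ∧ h t ≤ 0} T := by
      have hcl : IsClosed {t | 0 ≤ t ∧ h t ≤ 0} :=
        (isClosed_le continuous_const continuous_id).inter (isClosed_le hc continuous_const)
      exact ⟨_, hcl.isLeast_csInf ⟨t₁, ht₁, hneg⟩ ⟨0, fun t ht => ht.1⟩⟩
    have hTpos : 0 < T := by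
      refine lt_of_le_of_ne hT.1.1 fun h0 => ?_
      have := hT.1.2
      rw [← h0, hh0] at this
      linarith
    have hbefore : ∀ t, 0 ≤ t → t < T → 0 < h t := fun t ht0 htT => by
      by_contra hn
      exact absurd (hT.2 ⟨ht0, not_lt.1 hn⟩) (not_le.2 htT)
    have hT0 : h T = 0 := by
      refine le_antisymm hT.1.2 ?_
      have hlim : Filter.Tendsto h (𝓝[<] T) (𝓝 (h T)) := hc.continuousAt.tendsto.mono_left
        nhdsWithin_le_nhds
      refine ge_of_tendsto hlim ?_
      filter_upwards [Ioo_mem_nhdsLT hTpos] with t ht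
      exact (hbefore t ht.1.le ht.2).le
    have hh1T : h1 T < 0 := by
      have hpos : 0 < radialMean k (fun s => truncPow p (h s)) T := by
        refine intervalIntegral.intervalIntegral_pos_of_pos_on
          (Continuous.intervalIntegrable (by fun_prop) _ _) (fun τ hτ => ?_) zero_lt_one
        have e1 : T * τ ^ 2 < T := by
          have : τ ^ 2 < 1 := pow_lt_one₀ hτ.1.le hτ.2 (by norm_num)
          nlinarith
        have e2 : 0 ≤ T * τ ^ 2 := by positivity
        have e3 := hbefore _ e2 e1
        change 0 < τ ^ (k - 1) * truncPow p (h (T * τ ^ 2))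
        rw [truncPow_eq_rpow hp1 e3.le (hle1 _ e2)]
        have := hτ.1
        positivity
      simp only [h1def]
      linarith
    set m : ℝ := (k : ℝ) / 2 with hm
    have hm0 : 0 < m := by rw [hm]; linarith
    let P := pohozaev m p h h1
    have hPc : Continuous P := by
      have e1 : Continuous fun t : ℝ => t ^ m := Real.continuous_rpow_const hm0.le
      have e2 : Continuous fun t : ℝ => h t ^ (p + 1) :=
        hc.rpow_const fun _ => Or.inr (by linarith)
      exact e1.mul ((((continuous_const.mul continuous_id).mul (hh1c.pow 2)).add
        (e2.div_const _)).add ((continuous_const.mul hc).mul hh1c))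
    have hPanti : AntitoneOn P (Set.Icc 0 T) := by
      have hd : ∀ t ∈ Set.Ioo 0 T, HasDerivAt P
          (t ^ (m - 1) * h t ^ (p + 1) * (m / (p + 1) - (m - 1) / 2)) t := fun t ht => by
        have e0 := hbefore t ht.1.le ht.2
        refine hasDerivAt_pohozaev (by linarith) ht.1 e0 (hh t) (hh1 t) ?_
        have : 4 * t * h2 t + 2 * k * h1 t + truncPow p (h t) = 0 := heq t
        rw [truncPow_eq_rpow hp1 e0.le (hle1 t ht.1.le)] at this
        rw [hm]
        linarith
      refine antitoneOn_of_deriv_nonpos (convex_Icc 0 T) hPc.continuousOn ?_ ?_ <;>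
        rw [interior_Icc]
      · exact fun t ht => (hd t ht).differentiableAt.differentiableWithinAt
      · intro t ht
        rw [(hd t ht).deriv]
        have e0 := hbefore t ht.1.le ht.2
        have e1 := ht.1
        refine mul_nonpos_of_nonneg_of_nonpos (by positivity) ?_
        rw [sub_nonpos, div_le_div_iff₀ (by linarith) (by norm_num), hm]
        linarith
    have e1 := hPanti ⟨le_rfl, hTpos.le⟩ ⟨hTpos.le, le_rfl⟩ hTpos.le
    have e2 : P 0 = 0 := by
      simp only [P, pohozaev]
      rw [Real.zero_rpow hm0.ne', zero_mul]
    have e3 : 0 < P T := by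
      simp only [P, pohozaev]
      rw [hT0, Real.zero_rpow (by linarith)]
      have : 0 < h1 T ^ 2 := by nlinarith
      have : 0 < T ^ m * (2 * T * h1 T ^ 2) := by positivity
      simpa using this
    linarith
  refine ⟨h, h1, h2, hh2c, hh, hh1, hh2, hpos, fun t ht => ?_⟩
  have := heq t
  rwa [truncPow_eq_rpow hp1 (hpos t ht).le (hle1 t ht)] at this

theorem exists_pos_isClassicalSolution {N : ℕ} (hk : 2 < k) (hkN : k < N)
    (hp : ((k : ℝ) + 2) / (k - 2) ≤ p) :
    ∃ u : EuclideanSpace ℝ (Fin N) → ℝ, (∀ x, 0 < u x) ∧ IsClassicalSolution k p u := by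
  obtain ⟨h, h1, h2, hh2c, hh, hh1, hh2, hpos, heq⟩ := exists_pos_profile hk hp
  have hd : deriv h = h1 := funext fun t => (hh t).deriv
  have hd1 : deriv h1 = h2 := funext fun t => (hh1 t).deriv
  have hC1 : ContDiff ℝ 1 h1 :=
    contDiff_one_iff_deriv.2 ⟨fun t => (hh1 t).differentiableAt, by rwa [hd1]⟩
  have hC : ContDiff ℝ 2 h := by
    rw [show (2 : WithTop ℕ∞) = 1 + 1 by norm_num, contDiff_succ_iff_deriv]
    exact ⟨fun t => (hh t).differentiableAt, by simp, by rwa [hd]⟩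
  have hu : ContDiff ℝ 2 fun x : EuclideanSpace ℝ (Fin N) => h (‖x - 0‖ ^ 2) :=
    hC.comp ((contDiff_id.sub contDiff_const).norm_sq ℝ)
  refine ⟨_, fun x => hpos _ (by positivity), hu, fun x => ?_⟩
  rw [Pplus_hessian_comp_normSq_sub (by omega) hkN 0 x _ (Filter.EventuallyEq.refl _ _)
    (Filter.Eventually.of_forall hh) (hh1 _), max_eq_left (hh2 _)]
  have := heq (‖x - 0‖ ^ 2) (by positivity)
  linarith

end Solution

end TruncatedLaplacian

end

theorem theorem1p3 (N k : ℕ) (hk : 2 < k) (hkN : k < N) :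
    (∀ p : ℝ, 0 < p → p ≤ (k : ℝ) / ((k : ℝ) - 2) →
      ∀ u : EuclideanSpace ℝ (Fin N) → ℝ, (∀ x, 0 ≤ u x) →
        (TruncatedLaplacian.IsViscositySupersolution k p u ↔ ∀ x, u x = 0)) ∧
    (∀ p : ℝ, (k : ℝ) / ((k : ℝ) - 2) < p →
      ∃ u : EuclideanSpace ℝ (Fin N) → ℝ,
        (∀ x, 0 < u x) ∧ TruncatedLaplacian.IsClassicalSupersolution k p u) ∧
    (∀ p : ℝ, ((k : ℝ) + 2) / ((k : ℝ) - 2) ≤ p →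
      ∃ u : EuclideanSpace ℝ (Fin N) → ℝ,
        (∀ x, 0 < u x) ∧ TruncatedLaplacian.IsClassicalSolution k p u) ∧
    (∀ p : ℝ, (k : ℝ) / ((k : ℝ) - 2) < p → p < ((k : ℝ) + 2) / ((k : ℝ) - 2) →
      ¬ ∃ u : EuclideanSpace ℝ (Fin N) → ℝ,
        TruncatedLaplacian.IsRadial u ∧ (∀ x, 0 < u x) ∧
          TruncatedLaplacian.IsClassicalSolution k p u) := by
  have hk2 : (2 : ℝ) < k := by exact_mod_cast hk
  refine ⟨fun p hp hpk u hu0 => ?_, fun p hp => ?_, fun p hp => ?_, fun p hp1 hp2 => ?_⟩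
  · exact ⟨fun hu => hu.eq_zero hk hkN hp hpk hu0,
      TruncatedLaplacian.isViscositySupersolution_zero hp⟩
  · exact TruncatedLaplacian.exists_pos_isClassicalSupersolution hk hkN hp
  · exact TruncatedLaplacian.exists_pos_isClassicalSolution hk hkN hp
  · rintro ⟨u, hrad, hpos, hsol⟩
    have hp : 1 < p := by
      refine lt_trans ?_ hp1
      rw [one_lt_div (by linarith)]
      linarith
    exact TruncatedLaplacian.not_isClassicalSolution_of_isRadial hk hkN hp hp2 hrad hpos hsol
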